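/- Notation: $\{x\}=x-x^{-1}$, $D=\{A\}/\{q\}$, $\phi=A\{q\}$, $\bar\phi=-A^{-1}\{q\}$. The fundamental (unreduced, topologically framed) HOMFLY polynomial $H(q,A)$ of an oriented link diagram is the element of $\mathbb Z[q^{\pm1},A^{\pm1}][\{q\}^{-1}]$ whose value at $A=q^N$ is, for every $N\ge 1$, the Reshetikhin--Turaev invariant of the diagram for the fundamental representation of $U_q(\mathfrak{sl}_N)$ in the vertical framing, multiplied by $A^{-w}$, where $w$ is the writhe; thus $H(\text{unknot})=D$ and $A\,H_{+}-A^{-1}H_{-}=\{q\}\,H_{0}$. A bipartite diagram is a planar oriented link diagram glued entirely from antiparallel locks: a lock is the clasp (full twist) of two antiparallel strands; it is black if its two crossings are positive and white if they are negative. Let $v_\bullet$ and $v_\circ$ be the numbers of black and white locks and $v=v_\bullet+v_\circ$. Each lock has two planar resolutions: the unhooked one and the other orientation-preserving one, called smoothed. For each of the $2^v$ choices of resolutions let $a$ be the number of resulting planar cycles, and $b$ and $c$ the numbers of smoothed black and smoothed white locks. Then for every bipartite diagram: (1) The HOMFLY polynomial $H$ of the diagram exists, is unique, and equals $$H=A^{-2(v_\bullet-v_\circ)}\sum^{2^v}D^a\phi^b\bar\phi^c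 .$$ (2) At $A=q$, where $D=1$, the planar sum collapses: $$H\big|_{A=q}=q^{-2(v_\bullet-v_\circ)}\sum^{2^v}\phi^b\bar\phi^c\Big|_{A=q}=q^{-2(v_\bullet-v_\circ)}\,(1+\phi)^{v_\bullet}(1+\bar\phi)^{v_\circ}\Big|_{A=q}=1 .$$ (3) If the diagram represents a knot, there is a unique Laurent polynomial $F\in\mathbb Z[q^{\pm1},A^{\pm1}]$ (the cyclotomic function) such that $$H=D\cdot\big(1+F\,\{Aq\}\{A/q\}\big).$$ -/

import Mathlib

noncomputable section

namespace BipartiteHomfly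

open LaurentPolynomial

/-! ### Oriented link diagrams

A link diagram in the plane is put in general position with respect to the height function and
read from bottom to top.  A horizontal line meets it in finitely many strands; `true` is a strand
directed upwards and `false` a strand directed downwards.  By a planar isotopy one achieves that
at every crossing both strands are directed upwards. -/

/-- Which of the two crossings, and also the colour of a lock: the crossings of a black lock are
positive, the crossings of a white (opposite) lock are negative. -/
inductive Colour
  | black
  | white
  deriving DecidableEq

/-- Elementary pieces of an oriented link diagram.  `cup o` is a minimum and `cap o` a maximum whose
left end is directed upwards iff `o = true` (the right end has the opposite direction).
`cross .black` is the positive and `cross .white` the negative crossing of two upward strands. -/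
inductive Piece
  | cup (o : Bool)
  | cap (o : Bool)
  | cross (c : Colour)
  deriving DecidableEq

/-- A sequence of pieces from bottom to top; in `(k, p)` the piece `p` has exactly `k` strands to
its left. -/
abbrev Word := List (ℕ × Piece)

/-- The directions of the strands above a piece in terms of those below it
(`none` if the piece does not fit). -/
def Piece.step (k : ℕ) : Piece → List Bool → Option (List Bool)
  | .cup o, s => if k ≤ s.length then some (s.take k ++ o :: (!o) :: s.drop k) else none
  | .cap o, s =>
    match s.drop k with
    | a :: b :: r => if a = o ∧ b = (!o) then some (s.take k ++ r) else none
    | _ => none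
  | .cross _, s =>
    match s.drop k with
    | a :: b :: _ => if a = true ∧ b = true then some s else none
    | _ => none

/-- The directions of the strands above a word in terms of those below it. -/
def Word.run : Word → List Bool → Option (List Bool)
  | [], s => some s
  | (k, p) :: w, s => (p.step k s).bind (Word.run w)

/-- `w` is a link diagram: all pieces fit, and there are no loose ends. -/
def Word.IsLinkDiagram (w : Word) : Prop := w.run [] = some []

/-- The writhe: positive crossings minus negative crossings. -/
def Word.writhe (w : Word) : ℤ :=
  (w.map fun x => match x.2 with
    | .cross .black => (1 : ℤ)
    | .cross .white => -1
    | _ => 0).sum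

/-- State of the component count: every strand at the current height carries a label, and two
strands carry the same label iff they are joined below that height; `fresh` is an unused
label; `closed` counts the closed components completed so far. -/
structure Trace where
  labels : List ℕ
  fresh : ℕ
  closed : ℕ

/-- A minimum starts an arc, a crossing interchanges two strands, and a maximum joins two arcs or
closes one arc up. -/
def Trace.step (t : Trace) : ℕ × Piece → Trace
  | (k, .cup _) =>
    ⟨t.labels.take k ++ t.fresh :: t.fresh :: t.labels.drop k, t.fresh + 1, t.closed⟩
  | (k, .cap _) =>
    match t.labels.drop k with
    | a :: b :: r =>
      if a = b then ⟨t.labels.take k ++ r, t.fresh, t.closed + 1⟩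
      else ⟨(t.labels.take k ++ r).map fun x => if x = b then a else x, t.fresh, t.closed⟩
    | _ => t
  | (k, .cross _) =>
    match t.labels.drop k with
    | a :: b :: r => ⟨t.labels.take k ++ b :: a :: r, t.fresh, t.closed⟩
    | _ => t

/-- The number of components of the link (for a diagram without crossings: the number of its
planar cycles). -/
def Word.components (w : Word) : ℕ := (w.foldl Trace.step ⟨[], 0, 0⟩).closed

/-! ### The fundamental HOMFLY polynomial

For every `N ≥ 1` the Reshetikhin–Turaev functor of the fundamental representation of
`U_q(sl_N)`, in the vertical framing, is evaluated on the diagram.  The HOMFLY polynomial is the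
element of the ring of Laurent polynomials in `q` and `A`, with denominators powers of `q - q⁻¹`,
which interpolates the framing-corrected values at `A = q ^ N`. -/

/-- `{x} = x - x⁻¹`. -/
def bracket {R : Type*} [Ring R] (x : Rˣ) : R := (x : R) - ((x⁻¹ : Rˣ) : R)

/-- The variable `q` of `ℤ[q, q⁻¹]`. -/
def q₁ : (ℤ[T;T⁻¹])ˣ where
  val := T 1
  inv := T (-1)
  val_inv := by rw [← T_add]; simp
  inv_val := by rw [← T_add]; simp

/-- The R-matrix of the fundamental representation: its entry between colours `a, b` on top and
`c, d` at the bottom of a positive crossing; `R - R⁻¹ = {q}`. -/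
def rMatrix (N : ℕ) (a b c d : Fin N) : ℤ[T;T⁻¹] :=
  if a = b ∧ c = a ∧ d = a then (q₁ : ℤ[T;T⁻¹])
  else if c = b ∧ d = a then 1
  else if c = a ∧ d = b ∧ a < b then bracket q₁
  else 0

/-- The inverse of the R-matrix, for a negative crossing. -/
def rMatrixInv (N : ℕ) (a b c d : Fin N) : ℤ[T;T⁻¹] :=
  if a = b ∧ c = a ∧ d = a then ((q₁⁻¹ : (ℤ[T;T⁻¹])ˣ) : ℤ[T;T⁻¹])
  else if c = b ∧ d = a then 1
  else if c = a ∧ d = b ∧ b < a then -bracket q₁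
  else 0

/-- The weight of a minimum coloured by `c`. -/
def cupWeight (N : ℕ) (o : Bool) (c : Fin N) : ℤ[T;T⁻¹] :=
  if o then 1 else T ((N : ℤ) - 1 - 2 * (c : ℕ))

/-- The weight of a maximum coloured by `c`. -/
def capWeight (N : ℕ) (o : Bool) (c : Fin N) : ℤ[T;T⁻¹] :=
  if o then T (2 * ((c : ℕ) : ℤ) + 1 - N) else 1

/-- The action of a piece on tensors.  A tensor is given by its coordinates, one for each
colouring of the strands by the `N` basis vectors. -/
def Piece.act (N : ℕ) (v : List (Fin N) → ℤ[T;T⁻¹]) : ℕ × Piece → List (Fin N) → ℤ[T;T⁻¹]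
  | (k, .cup o), l =>
    match l.drop k with
    | a :: b :: r => if a = b then cupWeight N o a * v (l.take k ++ r) else 0
    | _ => 0
  | (k, .cap o), l => ∑ c : Fin N, capWeight N o c * v (l.take k ++ c :: c :: l.drop k)
  | (k, .cross .black), l =>
    match l.drop k with
    | a :: b :: r => ∑ c : Fin N, ∑ d : Fin N, rMatrix N a b c d * v (l.take k ++ c :: d :: r)
    | _ => 0
  | (k, .cross .white), l =>
    match l.drop k with
    | a :: b :: r => ∑ c : Fin N, ∑ d : Fin N, rMatrixInv N a b c d * v (l.take k ++ c :: d :: r)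
    | _ => 0

/-- The Reshetikhin–Turaev value of a link diagram in the vertical framing. -/
def Word.rt (N : ℕ) (w : Word) : ℤ[T;T⁻¹] :=
  w.foldl (Piece.act N) (fun l => if l = [] then 1 else 0) []

/-- The fundamental `sl_N` invariant in the topological framing:
the previous value times `A ^ (-writhe)` with `A = q ^ N`. -/
def Word.slN (N : ℕ) (w : Word) : ℤ[T;T⁻¹] :=
  (((q₁ ^ N) ^ (-w.writhe) : (ℤ[T;T⁻¹])ˣ) : ℤ[T;T⁻¹]) * w.rt N

/-- Laurent polynomials over `ℤ` in two variables: the outer variable is `A`, the inner one `q`. -/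
abbrev Laurent₂ := LaurentPolynomial (LaurentPolynomial ℤ)

/-- The field of fractions, in which `H` and `D` live. -/
abbrev 𝕂 := FractionRing Laurent₂

/-- The variable `q` in two-variable Laurent polynomials. -/
def q₂ : Laurent₂ˣ := Units.map (C : ℤ[T;T⁻¹] →+* Laurent₂).toMonoidHom q₁

/-- The variable `A` in two-variable Laurent polynomials. -/
def A₂ : Laurent₂ˣ where
  val := T 1
  inv := T (-1)
  val_inv := by rw [← T_add]; simp
  inv_val := by rw [← T_add]; simp

/-- The element `q` of the field of fractions. -/
def q : 𝕂ˣ := Units.map (algebraMap Laurent₂ 𝕂).toMonoidHom q₂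

/-- The element `A` of the field of fractions. -/
def A : 𝕂ˣ := Units.map (algebraMap Laurent₂ 𝕂).toMonoidHom A₂

/-- The substitution `A = q ^ N`. -/
def substA (N : ℕ) : Laurent₂ →+* ℤ[T;T⁻¹] := eval₂ (RingHom.id _) (q₁ ^ N)

/-- `H` is the (unreduced) fundamental HOMFLY polynomial of the link diagram `w`: it has the form
`P / {q} ^ m` with a Laurent polynomial `P` in `q` and `A`, and for all `N ≥ 1` its value at
`A = q ^ N` is the fundamental `sl_N` invariant. -/
def Word.IsHomfly (w : Word) (H : 𝕂) : Prop :=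
  ∃ (m : ℕ) (P : Laurent₂), algebraMap Laurent₂ 𝕂 P = bracket q ^ m * H ∧
    ∀ N : ℕ, 1 ≤ N → substA N P = bracket q₁ ^ m * w.slN N

/-! ### Bipartite diagrams -/

/-- The crossing of two downward strands at position `k`: the crossing of upward strands turned by
a half turn. -/
def crossDown (k : ℕ) (c : Colour) : Word :=
  [(k + 2, .cup true), (k + 3, .cup true), (k + 2, .cross c), (k + 1, .cap false), (k, .cap false)]

/-- The crossing with directions up, down below it and down, up above it: a quarter turn. -/
def crossUpDown (k : ℕ) (c : Colour) : Word :=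
  [(k, .cup false), (k + 1, .cross c), (k + 2, .cap true)]

/-- The crossing with directions down, up below it and up, down above it: a quarter turn. -/
def crossDownUp (k : ℕ) (c : Colour) : Word :=
  [(k + 2, .cup true), (k + 1, .cross c), (k, .cap false)]

/-- The direction of locking. -/
inductive Locking
  | vertical
  | horizontal
  deriving DecidableEq

/-- Elementary pieces of a bipartite diagram.  The two left ends of `lock d o c` are directed
upwards (bottom left in, top left out) iff `o = true`, the two right ends are directed oppositely;
`c` is the colour. -/
inductive BPiece
  | cup (o : Bool)
  | cap (o : Bool)
  | lock (d : Locking) (o : Bool) (c : Colour)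
  deriving DecidableEq

/-- A sequence of pieces of a bipartite diagram from bottom to top, with positions. -/
abbrev BWord := List (ℕ × BPiece)

/-- The antiparallel lock as a tangle with two crossings.  In a vertical lock an arc hanging down
from the two upper ends is hooked with an arc standing on the two lower ends; the horizontal lock
is the full twist of two antiparallel strands. -/
def lockWord (k : ℕ) : Locking → Bool → Colour → Word
  | .vertical, true, c =>
      [(k + 1, .cup true), (k, .cross c)] ++ crossDown (k + 2) c ++ [(k + 1, .cap true)]
  | .vertical, false, c =>
      [(k + 1, .cup false)] ++ crossDown k c ++ [(k + 2, .cross c), (k + 1, .cap false)]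
  | .horizontal, true, c => crossUpDown k c ++ crossDownUp k c
  | .horizontal, false, c => crossDownUp k c ++ crossUpDown k c

/-- The link diagram given by a bipartite diagram. -/
def BWord.link : BWord → Word
  | [] => []
  | (k, .cup o) :: B => (k, .cup o) :: BWord.link B
  | (k, .cap o) :: B => (k, .cap o) :: BWord.link B
  | (k, .lock d o c) :: B => lockWord k d o c ++ BWord.link B

/-- The number of locks of the given colour. -/
def BWord.count (B : BWord) (c : Colour) : ℕ :=
  (B.map fun x => match x.2 with
    | .lock _ _ c' => if c' = c then 1 else 0
    | _ => 0).sum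

/-- The unhooked lock: two horizontal arcs for a vertical lock (a maximum below a minimum), two
vertical strands for a horizontal one. -/
def unhooked (k : ℕ) : Locking → Bool → Word
  | .vertical, o => [(k, .cap o), (k, .cup o)]
  | .horizontal, _ => []

/-- The other planar resolution of the lock. -/
def smoothed (k : ℕ) : Locking → Bool → Word
  | .vertical, _ => []
  | .horizontal, o => [(k, .cap o), (k, .cup o)]

/-- A planar resolution of a bipartite diagram: the resulting system of cycles, and the numbers
`b` of black and `c` of white locks that are smoothed and not unhooked. -/
structure Resolution where
  cycles : Word
  b : ℕ
  c : ℕ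

/-- The list of all `2 ^ v` planar resolutions, where `v` is the number of locks. -/
def BWord.resolutions : BWord → List Resolution
  | [] => [⟨[], 0, 0⟩]
  | (k, .cup o) :: B => (BWord.resolutions B).map fun s => ⟨(k, .cup o) :: s.cycles, s.b, s.c⟩
  | (k, .cap o) :: B => (BWord.resolutions B).map fun s => ⟨(k, .cap o) :: s.cycles, s.b, s.c⟩
  | (k, .lock d o col) :: B =>
      ((BWord.resolutions B).map fun s => ⟨unhooked k d o ++ s.cycles, s.b, s.c⟩) ++
      ((BWord.resolutions B).map fun s => match col with
        | .black => ⟨smoothed k d o ++ s.cycles, s.b + 1, s.c⟩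
        | .white => ⟨smoothed k d o ++ s.cycles, s.b, s.c + 1⟩)

/-- The planar sum `∑ D ^ a * φ ^ b * φ' ^ c`, where `a` is the number of planar cycles. -/
def BWord.planarSum {R : Type*} [CommRing R] (B : BWord) (D φ φ' : R) : R :=
  (B.resolutions.map fun s => D ^ s.cycles.components * φ ^ s.b * φ' ^ s.c).sum

/-- `φ = A {q}`. -/
def phi {R : Type*} [CommRing R] (A q : Rˣ) : R := (A : R) * bracket q

/-- `φ̄ = -A⁻¹ {q}`. -/
def phiBar {R : Type*} [CommRing R] (A q : Rˣ) : R := -((A⁻¹ : Rˣ) : R) * bracket q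

/-- The framing factor `A ^ (-2 (v• - v∘))`, where `v•` and `v∘` are the numbers of black and of
white locks. -/
def BWord.framing {R : Type*} [CommRing R] (B : BWord) (A : Rˣ) : R :=
  ((A ^ (-2 * ((B.count .black : ℤ) - B.count .white)) : Rˣ) : R)

/-- `D = {A} / {q}`, the dimension of the fundamental representation. -/
def dim : 𝕂 := bracket A / bracket q

end BipartiteHomfly

end

open BipartiteHomfly

noncomputable section

namespace BipartiteHomfly

open LaurentPolynomial

set_option linter.unusedSimpArgs false

/-! Everything rests on one local identity. In the vertical framing, the tensor of an antiparallel
lock equals that of its unhooked resolution plus `col.skein * col.kink N` times that of its smoothed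
resolution (`Word.act_lock`). The coefficient is `{q} q^N` for black and `-{q} q^(-N)` for white,
that is, `φ` or `φ̄` at `A = q^N`. It comes from the Hecke relation for the R-matrix and a
telescoping sum over the intermediate colour, as in the evaluation of a kink.

Expanding all locks by linearity leaves crossingless diagrams. Pushing each maximum down through the
minima below it turns such a diagram into disjoint circles, each worth `[N] = quantumDim N`
(`Word.planar_eval`). Since `[N] {q} = {q^N}`, the planar sum with cleared denominators interpolates
all `sl_N` values (`BWord.isHomfly`). A Laurent polynomial vanishing at `A = q^N` for all `N ≥ 1` is
zero, whence uniqueness.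

With `D = 1` the planar sum factors over the locks, and `1 + x{x} = x^2`, `1 - x⁻¹{x} = x^(-2)`
cancel the framing factor for every unit `x` (`BWord.framing_mul`).

For a knot every resolution satisfies `1 ≤ a ≤ b + c + 1` and `a ≡ b + c + 1` modulo 2
(`BWord.components_resolution`). For the upper bound, unhooking preserves the connectivity of a
lock, and replacing an unhooked lock by a smoothed one changes the cycle count by at most one. For
the parity, the number of circles is the rotation number modulo 2, and each smoothing shifts the
latter by one. Hence `D^(a-1) φ^b φ̄^c` is a Laurent polynomial containing an even power
`{q}^(b+c+1-a)`. Modulo `{A}^2 - {q}^2 = {Aq}{A/q}` this power may be replaced by the same power of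
`{A}`; the sum then becomes the collapsed one at `x = A`, which is 1. So `H/D - 1` is divisible by
`{Aq}{A/q}`, and the quotient is unique because there are no zero divisors. -/

/-! ### Component counts -/

/-- All labels in use are below the next unused one. -/
def Trace.Valid (t : Trace) : Prop := ∀ x ∈ t.labels, x < t.fresh

/-- The number of closed components after reading `w` from the state `t`. -/
def Trace.count (t : Trace) (w : Word) : ℕ := (w.foldl Trace.step t).closed

@[simp] lemma Trace.count_nil (t : Trace) : t.count [] = t.closed := rfl

@[simp] lemma Trace.count_cons (t : Trace) (x : ℕ × Piece) (w : Word) :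
    t.count (x :: w) = (t.step x).count w := rfl

lemma Trace.count_append (t : Trace) (w w' : Word) :
    t.count (w ++ w') = (w.foldl Trace.step t).count w' := by
  simp [Trace.count]

lemma Word.components_eq (w : Word) : w.components = (⟨[], 0, 0⟩ : Trace).count w := rfl

/-! ### Comparing component counts of two states -/

/-- The labels of `t'` arise from those of `t` by a renaming which identifies at most `a` and
`b`. -/
def Sim (a b : ℕ) (t t' : Trace) : Prop :=
  t.Valid ∧ t'.Valid ∧ ∃ f : ℕ → ℕ, t'.labels = t.labels.map f ∧
    ∀ x ∈ t.labels, ∀ y ∈ t.labels, f x = f y → x = y ∨ (x = a ∧ y = b) ∨ (x = b ∧ y = a)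

lemma Trace.Valid.step {t : Trace} (h : t.Valid) (x : ℕ × Piece) : (t.step x).Valid := by
  obtain ⟨k, p⟩ := x
  obtain ⟨L, n, c⟩ := t
  simp only [Trace.Valid] at h ⊢
  have h1 : ∀ x ∈ L.take k, x < n := fun x hx => h x (List.mem_of_mem_take hx)
  have h2 : ∀ x ∈ L.drop k, x < n := fun x hx => h x (List.mem_of_mem_drop hx)
  cases p with
  | cup o =>
    intro x hx
    simp only [Trace.step, List.mem_append, List.mem_cons] at hx ⊢
    rcases hx with hx | rfl | rfl | hx
    · exact Nat.lt_succ_of_lt (h1 x hx)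
    · exact Nat.lt_succ_self _
    · exact Nat.lt_succ_self _
    · exact Nat.lt_succ_of_lt (h2 x hx)
  | cap o =>
    simp only [Trace.step]
    rcases hd : L.drop k with _ | ⟨a, _ | ⟨b, r⟩⟩
    · exact h
    · exact h
    · rw [hd] at h2
      simp only [List.mem_cons, forall_eq_or_imp] at h2
      dsimp only
      split_ifs
      · intro x hx
        rcases List.mem_append.1 hx with hx | hx
        · exact h1 x hx
        · exact h2.2.2 x hx
      · intro x hx
        obtain ⟨y, hy, rfl⟩ := List.mem_map.1 hx
        dsimp only
        split_ifs
        · exact h2.1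
        · rcases List.mem_append.1 hy with hx | hx
          · exact h1 y hx
          · exact h2.2.2 y hx
  | cross c =>
    simp only [Trace.step]
    rcases hd : L.drop k with _ | ⟨a, _ | ⟨b, r⟩⟩
    · exact h
    · exact h
    · rw [hd] at h2
      simp only [List.mem_cons, forall_eq_or_imp] at h2
      intro x hx
      simp only [List.mem_append, List.mem_cons] at hx
      rcases hx with hx | rfl | rfl | hx
      · exact h1 x hx
      · exact h2.2.1
      · exact h2.1
      · exact h2.2.2 x hx

lemma Trace.Valid.foldl {t : Trace} (h : t.Valid) (w : Word) :
    (w.foldl Trace.step t).Valid := by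
  induction w generalizing t with
  | nil => exact h
  | cons x w ih => exact ih (h.step x)

lemma Sim.cup {a b : ℕ} {t t' : Trace} (h : Sim a b t t') (k : ℕ) (o : Bool) :
    Sim a b (t.step (k, .cup o)) (t'.step (k, .cup o)) := by
  obtain ⟨hv, hv', f, hL, hf⟩ := h
  -- The fresh label goes to the fresh label. No new coincidence arises, because validity keeps all
  -- other images below `t'.fresh`.
  refine ⟨hv.step _, hv'.step _, fun x => if x = t.fresh then t'.fresh else f x, ?_, ?_⟩
  · have h1 : ∀ x ∈ t.labels.take k, (if x = t.fresh then t'.fresh else f x) = f x :=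
      fun x hx => if_neg (hv x (List.mem_of_mem_take hx)).ne
    have h2 : ∀ x ∈ t.labels.drop k, (if x = t.fresh then t'.fresh else f x) = f x :=
      fun x hx => if_neg (hv x (List.mem_of_mem_drop hx)).ne
    simp only [Trace.step, hL, List.map_append, List.map_cons, if_true, List.map_congr_left h1,
      List.map_congr_left h2, List.map_take, List.map_drop]
  · have key : ∀ x ∈ (t.step (k, .cup o)).labels, x = t.fresh ∨ x ∈ t.labels := by
      intro x hx
      simp only [Trace.step, List.mem_append, List.mem_cons] at hx
      rcases hx with hx | rfl | rfl | hx
      · exact Or.inr (List.mem_of_mem_take hx)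
      · exact Or.inl rfl
      · exact Or.inl rfl
      · exact Or.inr (List.mem_of_mem_drop hx)
    have hlt : ∀ x ∈ t.labels, f x < t'.fresh := fun x hx =>
      hv' _ (hL ▸ List.mem_map_of_mem hx)
    intro x hx y hy hxy
    rcases key x hx with rfl | hx <;> rcases key y hy with rfl | hy
    · exact Or.inl rfl
    · have := hlt y hy
      have := hv y hy
      grind
    · have := hlt x hx
      have := hv x hx
      grind
    · have := hv x hx
      have := hv y hy
      grind

lemma Sim.cross {a b : ℕ} {t t' : Trace} (h : Sim a b t t') (k : ℕ) (c : Colour) :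
    Sim a b (t.step (k, .cross c)) (t'.step (k, .cross c)) := by
  obtain ⟨hv, hv', f, hL, hf⟩ := h
  refine ⟨hv.step _, hv'.step _, f, ?_, ?_⟩
  · simp only [Trace.step, hL, ← List.map_drop]
    rcases hd : t.labels.drop k with _ | ⟨x, _ | ⟨y, r⟩⟩ <;> simp [hL, List.map_take]
  · have key : ∀ x ∈ (t.step (k, .cross c)).labels, x ∈ t.labels := by
      intro x hx
      have h2 : ∀ x ∈ t.labels.drop k, x ∈ t.labels := fun x hx => List.mem_of_mem_drop hx
      simp only [Trace.step] at hx
      rcases hd : t.labels.drop k with _ | ⟨y, _ | ⟨z, r⟩⟩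
      · simpa [hd] using hx
      · simpa [hd] using hx
      · rw [hd] at hx h2
        simp only [List.mem_append, List.mem_cons] at hx h2
        rcases hx with hx | rfl | rfl | hx
        · exact List.mem_of_mem_take hx
        · exact h2 _ (by simp)
        · exact h2 _ (by simp)
        · exact h2 _ (by simp [hx])
    exact fun x hx y hy => hf x (key x hx) y (key y hy)

/-- The two states differ in behaviour only when the maximum joins two arcs that are distinct in `t`
but already identified in `t'`: then `t'` closes a component where `t` merges two arcs. That uses up
the single permitted identification, so the renaming is injective afterwards. -/
lemma Sim.cap {a b : ℕ} {t t' : Trace} (h : Sim a b t t') (k : ℕ) (o : Bool) :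
    (∃ a' b', (a = b → a' = b') ∧ Sim a' b' (t.step (k, .cap o)) (t'.step (k, .cap o)) ∧
      (t'.step (k, .cap o)).closed + t.closed = (t.step (k, .cap o)).closed + t'.closed) ∨
    (a ≠ b ∧ ∃ c, Sim c c (t.step (k, .cap o)) (t'.step (k, .cap o)) ∧
      (t'.step (k, .cap o)).closed + t.closed =
        (t.step (k, .cap o)).closed + t'.closed + 1) := by
  have hv2 := h.1.step (k, .cap o)
  have hv2' := h.2.1.step (k, .cap o)
  obtain ⟨hv, hv', f, hL, hf⟩ := h
  obtain ⟨L, n, c⟩ := t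
  obtain ⟨L', n', c'⟩ := t'
  dsimp only at hL hf
  subst hL
  have h1 : ∀ x ∈ L.drop k, x ∈ L := fun x hx => List.mem_of_mem_drop hx
  have h0 : ∀ x ∈ L.take k, x ∈ L := fun x hx => List.mem_of_mem_take hx
  simp only [Sim, hv2, hv2', true_and]
  simp only [Trace.step, ← List.map_drop, ← List.map_take]
  rcases hd : L.drop k with _ | ⟨x, _ | ⟨y, r⟩⟩
  · exact Or.inl ⟨a, b, id, ⟨f, rfl, hf⟩, by simp; omega⟩
  · exact Or.inl ⟨a, b, id, ⟨f, rfl, hf⟩, by simp; omega⟩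
  · rw [hd] at h1
    have hx : x ∈ L := h1 x (by simp)
    have hy : y ∈ L := h1 y (by simp)
    have hm : ∀ z ∈ L.take k ++ r, z ∈ L := by
      intro z hz
      rcases List.mem_append.1 hz with hz | hz
      · exact h0 z hz
      · exact h1 z (by simp [hz])
    simp only [List.map_cons, ← List.map_append]
    generalize L.take k ++ r = M at hm
    by_cases hxy : x = y
    · subst hxy
      simp only [if_true]
      exact Or.inl ⟨a, b, id, ⟨f, rfl, fun z hz w hw => hf z (hm z hz) w (hm w hw)⟩, by omega⟩
    · by_cases hfxy : f x = f y
      · have hab := hf x hx y hy hfxy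
        simp only [hxy, hfxy, if_true, if_false]
        -- The value `0` is arbitrary: for equal parameters `Sim` says that the renaming is
        -- injective on the labels.
        refine Or.inr ⟨by grind, 0, ⟨f, ?_, ?_⟩, by omega⟩
        · simp only [List.map_map]
          refine List.map_congr_left fun z hz => ?_
          simp only [Function.comp]
          split_ifs with h <;> simp [h, hfxy]
        · simp only [List.mem_map]
          rintro _ ⟨z, hz, rfl⟩ _ ⟨w, hw, rfl⟩ hzw
          have := hf z (hm z hz) w (hm w hw)
          grind
      · simp only [hxy, hfxy, if_false]
        -- The maximum relabels `y` as `x` in `t`, so the exceptional pair has to follow that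
        -- relabelling.
        refine Or.inl ⟨if a = y then x else a, if b = y then x else b, by grind,
          ⟨fun z => if f z = f y then f x else f z, ?_, ?_⟩, by omega⟩
        · simp only [List.map_map]
          refine List.map_congr_left fun z hz => ?_
          simp only [Function.comp]
          grind
        · simp only [List.mem_map]
          rintro _ ⟨z, hz, rfl⟩ _ ⟨w, hw, rfl⟩ hzw
          have e : ∀ v : ℕ, (if f (if v = y then x else v) = f y then f x
              else f (if v = y then x else v)) = if f v = f y then f x else f v := by
            intro v
            by_cases hvy : v = y
            · simp [hvy, hfxy]
            · simp [hvy]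
          simp only [e] at hzw
          have h1 := hf z (hm z hz) w (hm w hw)
          have h2 := hf z (hm z hz) y hy
          have h3 := hf w (hm w hw) y hy
          have h4 := hf z (hm z hz) x hx
          have h5 := hf w (hm w hw) x hx
          clear e hf hm h0 hv2 hv2' hv hv' hd hx hy
          by_cases hzy : f z = f y
          · by_cases hwy : f w = f y
            · grind
            · rw [if_pos hzy, if_neg hwy] at hzw
              grind
          · by_cases hwy : f w = f y
            · rw [if_neg hzy, if_pos hwy] at hzw
              grind
            · rw [if_neg hzy, if_neg hwy] at hzw
              grind

lemma Sim.step {a b : ℕ} {t t' : Trace} (h : Sim a b t t') (x : ℕ × Piece) :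
    (∃ a' b', (a = b → a' = b') ∧ Sim a' b' (t.step x) (t'.step x) ∧
      (t'.step x).closed + t.closed = (t.step x).closed + t'.closed) ∨
    (a ≠ b ∧ ∃ c, Sim c c (t.step x) (t'.step x) ∧
      (t'.step x).closed + t.closed = (t.step x).closed + t'.closed + 1) := by
  obtain ⟨k, o | o | c⟩ := x
  · exact Or.inl ⟨a, b, id, h.cup k o, Nat.add_comm _ _⟩
  · exact h.cap k o
  · refine Or.inl ⟨a, b, id, h.cross k c, ?_⟩
    have : ∀ t : Trace, (t.step (k, .cross c)).closed = t.closed := by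
      intro t
      simp only [Trace.step]
      rcases t.labels.drop k with _ | ⟨x, _ | ⟨y, r⟩⟩ <;> rfl
    rw [this, this, Nat.add_comm]

/-- Equal parameters mean an injective renaming, so both states close components at the same
moments. -/
lemma Sim.count_eq {a : ℕ} {t t' : Trace} (h : Sim a a t t') (w : Word) :
    t'.count w + t.closed = t.count w + t'.closed := by
  induction w generalizing t t' a with
  | nil => simp; omega
  | cons x w ih =>
    rcases h.step x with ⟨a', b', hab, hs, hc⟩ | ⟨hne, _⟩
    · obtain rfl := hab rfl
      have := ih hs
      simp only [Trace.count_cons]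
      omega
    · exact absurd rfl hne

/-- The extra closure in `Sim.cap` can occur at most once, since it makes the renaming injective. -/
lemma Sim.count_le {a b : ℕ} {t t' : Trace} (h : Sim a b t t') (w : Word) :
    t.count w + t'.closed ≤ t'.count w + t.closed ∧
      t'.count w + t.closed ≤ t.count w + t'.closed + 1 := by
  induction w generalizing t t' a b with
  | nil => simp; omega
  | cons x w ih =>
    rcases h.step x with ⟨a', b', -, hs, hc⟩ | ⟨-, c, hs, hc⟩
    · have := ih hs
      simp only [Trace.count_cons]
      omega
    · have := hs.count_eq w
      simp only [Trace.count_cons]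
      omega

/-! ### Trace steps to the right of a fixed block of strands -/

section local_moves

variable {pre : List ℕ} {k : ℕ}

lemma Trace.step_cup (hk : pre.length = k) (r : List ℕ) (n c i : ℕ) (o : Bool) :
    (⟨pre ++ r, n, c⟩ : Trace).step (k + i, .cup o) =
      ⟨pre ++ (r.take i ++ n :: n :: r.drop i), n + 1, c⟩ := by
  subst hk
  simp [Trace.step, List.take_length_add_append]

lemma Trace.step_cross (hk : pre.length = k) (r : List ℕ) (n c i : ℕ) (col : Colour) :
    (⟨pre ++ r, n, c⟩ : Trace).step (k + i, .cross col) =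
      match r.drop i with
      | a :: b :: r' => ⟨pre ++ (r.take i ++ b :: a :: r'), n, c⟩
      | _ => ⟨pre ++ r, n, c⟩ := by
  subst hk
  simp only [Trace.step, List.drop_length_add_append, List.take_length_add_append,
    List.append_assoc]

lemma Trace.step_cap (hk : pre.length = k) (r : List ℕ) (n c i : ℕ) (o : Bool) :
    (⟨pre ++ r, n, c⟩ : Trace).step (k + i, .cap o) =
      match r.drop i with
      | a :: b :: r' =>
        if a = b then ⟨pre ++ (r.take i ++ r'), n, c + 1⟩
        else ⟨pre.map (fun z => if z = b then a else z) ++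
          (r.take i ++ r').map fun z => if z = b then a else z, n, c⟩
      | _ => ⟨pre ++ r, n, c⟩ := by
  subst hk
  simp only [Trace.step, List.drop_length_add_append, List.take_length_add_append,
    List.append_assoc, List.map_append]

lemma Trace.step_cup_zero (hk : pre.length = k) (r : List ℕ) (n c : ℕ) (o : Bool) :
    (⟨pre ++ r, n, c⟩ : Trace).step (k, .cup o) = ⟨pre ++ n :: n :: r, n + 1, c⟩ :=
  Trace.step_cup hk r n c 0 o

lemma Trace.step_cross_zero (hk : pre.length = k) (r : List ℕ) (n c : ℕ) (col : Colour) :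
    (⟨pre ++ r, n, c⟩ : Trace).step (k, .cross col) =
      match r with
      | a :: b :: r' => ⟨pre ++ b :: a :: r', n, c⟩
      | _ => ⟨pre ++ r, n, c⟩ :=
  Trace.step_cross hk r n c 0 col

lemma Trace.step_cap_zero (hk : pre.length = k) (r : List ℕ) (n c : ℕ) (o : Bool) :
    (⟨pre ++ r, n, c⟩ : Trace).step (k, .cap o) =
      match r with
      | a :: b :: r' =>
        if a = b then ⟨pre ++ r', n, c + 1⟩
        else ⟨pre.map (fun z => if z = b then a else z) ++
          r'.map fun z => if z = b then a else z, n, c⟩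
      | _ => ⟨pre ++ r, n, c⟩ :=
  Trace.step_cap hk r n c 0 o

end local_moves

/-! ### Locks and the component count -/

section lock_count

variable {pre r : List ℕ} {x y n c k : ℕ}

lemma map_congr_of_lt {l : List ℕ} (hl : ∀ z ∈ l, z < n) {f g : ℕ → ℕ} (h : ∀ z < n, f z = g z) :
    l.map f = l.map g :=
  List.map_congr_left fun z hz => h z (hl z hz)

lemma Trace.valid_split (h : (⟨pre ++ x :: y :: r, n, c⟩ : Trace).Valid) :
    (∀ z ∈ pre, z < n) ∧ (∀ z ∈ r, z < n) ∧ x < n ∧ y < n := by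
  refine ⟨fun z hz => h z ?_, fun z hz => h z ?_, h x ?_, h y ?_⟩ <;> simp_all

/-- The two crossings exchange the strands twice; the auxiliary minima and maxima only rename one of
the two strands by a fresh label. -/
lemma Sim.horizontal (h : (⟨pre ++ x :: y :: r, n, c⟩ : Trace).Valid) (hk : pre.length = k)
    (o : Bool) (col : Colour) :
    Sim 0 0 ⟨pre ++ x :: y :: r, n, c⟩
        ((lockWord k .horizontal o col).foldl Trace.step ⟨pre ++ x :: y :: r, n, c⟩) ∧
      ((lockWord k .horizontal o col).foldl Trace.step ⟨pre ++ x :: y :: r, n, c⟩).closed = c := by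
  obtain ⟨hp, hr, hx, hy⟩ := Trace.valid_split h
  have h1 : n ≠ x ∧ n + 1 ≠ x ∧ x ≠ n ∧ x ≠ n + 1 := by omega
  have h2 : n ≠ y ∧ n + 1 ≠ y ∧ y ≠ n ∧ y ≠ n + 1 := by omega
  have hv := h.foldl (lockWord k .horizontal o col)
  have hlt : ∀ z ∈ pre ++ x :: y :: r, z < n := h
  revert hv
  cases o
  all_goals
    intro hv
    refine ⟨⟨h, hv, ?_⟩, ?_⟩
  · refine ⟨fun z => if z = x then n + 1 else z, ?_, ?_⟩
    · simp only [lockWord, crossUpDown, crossDownUp, List.cons_append, List.nil_append,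
        List.foldl_cons, List.foldl_nil, hk, Trace.step_cup, Trace.step_cup_zero, Trace.step_cap,
        Trace.step_cap_zero, Trace.step_cross, Trace.step_cross_zero, h1, h2, List.map_append,
        List.length_map, List.take_succ_cons, List.take_zero, List.drop_succ_cons, List.drop_zero,
        List.map_cons, if_true, if_false, List.map_map, List.cons.injEq]
      congr 1
      · exact map_congr_of_lt hp fun z hz => by grind
      · simp only [List.cons.injEq, true_and]
        exact map_congr_of_lt hr fun z hz => by grind
    · intro z hz w hw hzw
      have := hlt z hz
      have := hlt w hw
      grind
  · simp [lockWord, crossUpDown, crossDownUp, hk, Trace.step_cup, Trace.step_cup_zero,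
      Trace.step_cap, Trace.step_cap_zero, Trace.step_cross, Trace.step_cross_zero, h1, h2]
  · refine ⟨fun z => if z = y then n else z, ?_, ?_⟩
    · simp only [lockWord, crossUpDown, crossDownUp, List.cons_append, List.nil_append,
        List.foldl_cons, List.foldl_nil, hk, Trace.step_cup, Trace.step_cup_zero, Trace.step_cap,
        Trace.step_cap_zero, Trace.step_cross, Trace.step_cross_zero, h1, h2, List.map_append,
        List.length_map, List.take_succ_cons, List.take_zero, List.drop_succ_cons, List.drop_zero,
        List.map_cons, if_true, if_false, List.map_map, List.cons.injEq]
      rw [if_neg (by omega)]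
      simp only [List.map_append, List.map_cons, List.map_map]
      congr 1
      · exact map_congr_of_lt hp fun z hz => by grind
      · simp only [List.cons.injEq]
        refine ⟨by grind, by grind, ?_⟩
        exact map_congr_of_lt hr fun z hz => by grind
    · intro z hz w hw hzw
      have := hlt z hz
      have := hlt w hw
      grind
  · simp [lockWord, crossUpDown, crossDownUp, hk, Trace.step_cup, Trace.step_cup_zero,
      Trace.step_cap, Trace.step_cap_zero, Trace.step_cross, Trace.step_cross_zero, h1, h2]

lemma Trace.foldl_cap_cup (hk : pre.length = k) (o o' : Bool) :
    [(k, Piece.cap o), (k, Piece.cup o')].foldl Trace.step ⟨pre ++ x :: y :: r, n, c⟩ =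
      if x = y then ⟨pre ++ n :: n :: r, n + 1, c + 1⟩
      else ⟨pre.map (fun z => if z = y then x else z) ++
        n :: n :: r.map fun z => if z = y then x else z, n + 1, c⟩ := by
  by_cases hxy : x = y <;>
  simp [hk, Trace.step_cup_zero, Trace.step_cap_zero, hxy]

/-- Connectivity ignores the clasp, so the result agrees with that of a maximum followed by a
minimum. The only difference is the label supply: a vertical lock contains three minima, hence `n +
3`. -/
lemma Trace.foldl_vertical (h : (⟨pre ++ x :: y :: r, n, c⟩ : Trace).Valid) (hk : pre.length = k)
    (o : Bool) (col : Colour) :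
    (lockWord k .vertical o col).foldl Trace.step ⟨pre ++ x :: y :: r, n, c⟩ =
      if x = y then ⟨pre ++ n :: n :: r, n + 3, c + 1⟩
      else ⟨pre.map (fun z => if z = y then x else z) ++
        n :: n :: r.map fun z => if z = y then x else z, n + 3, c⟩ := by
  obtain ⟨hp, hr, hx, hy⟩ := Trace.valid_split h
  have h1 : n ≠ x ∧ n + 1 ≠ x ∧ n + 2 ≠ x ∧ x ≠ n ∧ x ≠ n + 1 ∧ x ≠ n + 2 := by omega
  have h2 : n ≠ y ∧ n + 1 ≠ y ∧ n + 2 ≠ y ∧ y ≠ n ∧ y ≠ n + 1 ∧ y ≠ n + 2 := by omega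
  have key : ∀ (l : List ℕ) (a b : ℕ), (∀ z ∈ l, z < n) →
      l.map ((fun z => if z = n + 1 then a else z) ∘ fun z => if z = n + 2 then b else z) = l := by
    intro l a b hl
    conv_rhs => rw [← List.map_id l]
    exact map_congr_of_lt hl fun z hz => by grind
  have key' : ∀ (l : List ℕ) (a b : ℕ), (∀ z ∈ l, z < n) →
      l.map ((fun z => if z = y then x else z) ∘
        (fun z => if z = n + 1 then a else z) ∘ fun z => if z = n + 2 then b else z) =
      l.map fun z => if z = y then x else z := by
    intro l a b hl
    exact map_congr_of_lt hl fun z hz => by grind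
  cases o
  · simp [lockWord, crossDown, hk, Trace.step_cup, Trace.step_cup_zero, Trace.step_cap,
      Trace.step_cap_zero, Trace.step_cross, Trace.step_cross_zero, h1, h2, key _ _ _ hp,
      key _ _ _ hr, key' _ _ _ hp, key' _ _ _ hr, add_assoc]
  · simp [lockWord, crossDown, hk, Trace.step_cup, Trace.step_cap,
      Trace.step_cross, Trace.step_cross_zero, h1, h2, key _ _ _ hp,
      key _ _ _ hr, key' _ _ _ hp, key' _ _ _ hr, add_assoc]

lemma Sim.of_labels_eq {t t' : Trace} (h : t.Valid) (h' : t'.Valid) (hl : t.labels = t'.labels) :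
    Sim 0 0 t t' :=
  ⟨h, h', id, by simp [hl], fun _ _ _ _ h => Or.inl h⟩

lemma Trace.count_lock (h : (⟨pre ++ x :: y :: r, n, c⟩ : Trace).Valid) (hk : pre.length = k)
    (d : Locking) (o : Bool) (col : Colour) (w : Word) :
    (⟨pre ++ x :: y :: r, n, c⟩ : Trace).count (lockWord k d o col ++ w) =
      (⟨pre ++ x :: y :: r, n, c⟩ : Trace).count (unhooked k d o ++ w) := by
  rw [Trace.count_append, Trace.count_append]
  cases d
  · have hs : Sim 0 0 ((unhooked k .vertical o).foldl Trace.step ⟨pre ++ x :: y :: r, n, c⟩)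
        ((lockWord k .vertical o col).foldl Trace.step ⟨pre ++ x :: y :: r, n, c⟩) := by
      refine Sim.of_labels_eq (h.foldl _) (h.foldl _) ?_
      rw [Trace.foldl_vertical h hk, unhooked, Trace.foldl_cap_cup hk]
      split_ifs <;> rfl
    have := hs.count_eq w
    have hc : ((unhooked k .vertical o).foldl Trace.step ⟨pre ++ x :: y :: r, n, c⟩).closed =
        ((lockWord k .vertical o col).foldl Trace.step ⟨pre ++ x :: y :: r, n, c⟩).closed := by
      rw [Trace.foldl_vertical h hk, unhooked, Trace.foldl_cap_cup hk]
      split_ifs <;> rfl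
    omega
  · have hs := Sim.horizontal h hk o col
    have := hs.1.count_eq w
    have h2 := hs.2
    simp only [unhooked, List.foldl_nil] at this ⊢
    omega

/-- Both states are compared with a common quotient, in which the two lower and the two upper ends
all lie on one arc. Each differs from it by a single identification. -/
lemma Trace.count_cap_cup (h : (⟨pre ++ x :: y :: r, n, c⟩ : Trace).Valid) (hk : pre.length = k)
    (o : Bool) (w : Word) :
    (⟨pre ++ x :: y :: r, n, c⟩ : Trace).count w ≤
        (⟨pre ++ x :: y :: r, n, c⟩ : Trace).count ([(k, .cap o), (k, .cup o)] ++ w) + 1 ∧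
      (⟨pre ++ x :: y :: r, n, c⟩ : Trace).count ([(k, .cap o), (k, .cup o)] ++ w) ≤
        (⟨pre ++ x :: y :: r, n, c⟩ : Trace).count w + 1 := by
  obtain ⟨hp, hr, hx, hy⟩ := Trace.valid_split h
  rw [Trace.count_append]
  have hv := h.foldl [(k, Piece.cap o), (k, Piece.cup o)]
  rw [Trace.foldl_cap_cup hk] at hv ⊢
  have hlt : ∀ z ∈ pre ++ x :: y :: r, z < n := h
  split_ifs at hv ⊢ with hxy
  · subst hxy
    -- Here the original state is itself the quotient: identifying the new arc `n` with `x` recovers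
    -- it, apart from the one component already closed.
    have hs : Sim n x ⟨pre ++ n :: n :: r, n + 1, c + 1⟩ ⟨pre ++ x :: x :: r, n, c⟩ := by
      refine ⟨hv, h, fun z => if z = n then x else z, ?_, ?_⟩
      · have e : ∀ l : List ℕ, (∀ z ∈ l, z < n) → l.map (fun z => if z = n then x else z) = l := by
          intro l hl
          conv_rhs => rw [← List.map_id l]
          exact map_congr_of_lt hl fun z hz => by grind
        simp [e _ hp, e _ hr]
      · intro z _ w _ hzw
        grind
    have := hs.count_le w
    dsimp only at this
    omega
  · set m : ℕ → ℕ := fun z => if z = y then x else z with hm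
    have hv3 : (⟨pre.map m ++ x :: x :: r.map m, n, c⟩ : Trace).Valid := by
      intro z hz
      simp only [List.mem_append, List.mem_cons, List.mem_map] at hz
      grind
    have hs1 : Sim x y ⟨pre ++ x :: y :: r, n, c⟩ ⟨pre.map m ++ x :: x :: r.map m, n, c⟩ := by
      refine ⟨h, hv3, m, by simp [hm], ?_⟩
      intro z _ w _ hzw
      grind
    have hs2 : Sim n x ⟨pre.map m ++ n :: n :: r.map m, n + 1, c⟩
        ⟨pre.map m ++ x :: x :: r.map m, n, c⟩ := by
      refine ⟨hv, hv3, fun z => if z = n then x else z, ?_, ?_⟩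
      · have e : ∀ l : List ℕ, (∀ z ∈ l, z < n) →
            (l.map m).map (fun z => if z = n then x else z) = l.map m := by
          intro l hl
          rw [List.map_map]
          exact map_congr_of_lt hl fun z hz => by grind
        simp only [List.map_append, List.map_cons, if_true, e _ hp, e _ hr]
      · intro z _ w _ hzw
        grind
    have := hs1.count_le w
    have := hs2.count_le w
    dsimp only at *
    omega

end lock_count

/-! ### Orientations -/

lemma Word.run_append (w w' : Word) (s : List Bool) :
    Word.run (w ++ w') s = (Word.run w s).bind (Word.run w') := by
  induction w generalizing s with
  | nil => rfl
  | cons x w ih =>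
    obtain ⟨k, p⟩ := x
    simp only [List.cons_append, Word.run]
    cases p.step k s with
    | none => rfl
    | some s1 => exact ih s1

lemma Piece.step_cap_iff (k : ℕ) (o : Bool) (s s' : List Bool) :
    Piece.step k (.cap o) s = some s' ↔
      ∃ pre r, pre.length = k ∧ s = pre ++ o :: (!o) :: r ∧ s' = pre ++ r := by
  constructor
  · intro h
    simp only [Piece.step] at h
    rcases hd : s.drop k with _ | ⟨a, _ | ⟨b, r⟩⟩
    · simp [hd] at h
    · simp [hd] at h
    · rw [hd] at h
      dsimp only at h
      split_ifs at h with hab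
      obtain ⟨rfl, rfl⟩ := hab
      have hlen : k ≤ s.length := by
        by_contra hlt
        rw [List.drop_of_length_le (by omega)] at hd
        simp at hd
      exact ⟨s.take k, r, by simp [hlen], by rw [← hd, List.take_append_drop],
        (Option.some.inj h).symm⟩
  · rintro ⟨pre, r, rfl, rfl, rfl⟩
    simp [Piece.step]

lemma Piece.step_cross_iff (k : ℕ) (c : Colour) (s s' : List Bool) :
    Piece.step k (.cross c) s = some s' ↔
      ∃ pre r, pre.length = k ∧ s = pre ++ true :: true :: r ∧ s' = s := by
  constructor
  · intro h
    simp only [Piece.step] at h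
    rcases hd : s.drop k with _ | ⟨a, _ | ⟨b, r⟩⟩
    · simp [hd] at h
    · simp [hd] at h
    · rw [hd] at h
      dsimp only at h
      split_ifs at h with hab
      obtain ⟨rfl, rfl⟩ := hab
      have hlen : k ≤ s.length := by
        by_contra hlt
        rw [List.drop_of_length_le (by omega)] at hd
        simp at hd
      exact ⟨s.take k, r, by simp [hlen], by rw [← hd, List.take_append_drop],
        (Option.some.inj h).symm⟩
  · rintro ⟨pre, r, rfl, rfl, rfl⟩
    simp [Piece.step]

lemma Piece.step_cup_iff (k : ℕ) (o : Bool) (s s' : List Bool) :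
    Piece.step k (.cup o) s = some s' ↔
      ∃ pre r, pre.length = k ∧ s = pre ++ r ∧ s' = pre ++ o :: (!o) :: r := by
  constructor
  · intro h
    simp only [Piece.step] at h
    split_ifs at h with hk
    exact ⟨s.take k, s.drop k, by simp [hk], (List.take_append_drop k s).symm,
      (Option.some.inj h).symm⟩
  · rintro ⟨pre, r, rfl, rfl, rfl⟩
    simp [Piece.step]

/-! ### Locality: translating words to position zero -/

/-- The word `w` with `k` additional strands on the left. -/
def Word.shift (k : ℕ) (w : Word) : Word := w.map fun x => (k + x.1, x.2)

@[simp] lemma Word.shift_nil (k : ℕ) : Word.shift k [] = [] := rfl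

@[simp] lemma Word.shift_cons (k i : ℕ) (p : Piece) (w : Word) :
    Word.shift k ((i, p) :: w) = (k + i, p) :: Word.shift k w := rfl

lemma lockWord_shift (k : ℕ) (d : Locking) (o : Bool) (c : Colour) :
    lockWord k d o c = Word.shift k (lockWord 0 d o c) := by
  cases d <;> cases o <;> simp [lockWord, crossDown, crossUpDown, crossDownUp, add_assoc]

lemma unhooked_shift (k : ℕ) (d : Locking) (o : Bool) :
    unhooked k d o = Word.shift k (unhooked 0 d o) := by
  cases d <;> rfl

lemma smoothed_shift (k : ℕ) (d : Locking) (o : Bool) :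
    smoothed k d o = Word.shift k (smoothed 0 d o) := by
  cases d <;> rfl

lemma Piece.step_add (pre r : List Bool) (i : ℕ) (p : Piece) :
    Piece.step (pre.length + i) p (pre ++ r) = (Piece.step i p r).map (pre ++ ·) := by
  cases p with
  | cup o =>
    simp only [Piece.step, List.length_append, Nat.add_le_add_iff_left,
      List.take_length_add_append, List.drop_length_add_append, List.append_assoc]
    split_ifs <;> rfl
  | cap o =>
    simp only [Piece.step, List.take_length_add_append, List.drop_length_add_append,
      List.append_assoc]
    rcases r.drop i with _ | ⟨a, _ | ⟨b, r'⟩⟩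
    · rfl
    · rfl
    · dsimp only
      split_ifs <;> rfl
  | cross c =>
    simp only [Piece.step, List.take_length_add_append, List.drop_length_add_append]
    rcases r.drop i with _ | ⟨a, _ | ⟨b, r'⟩⟩
    · rfl
    · rfl
    · dsimp only
      split_ifs <;> rfl

lemma Word.run_shift (pre r : List Bool) (w : Word) :
    Word.run (Word.shift pre.length w) (pre ++ r) = (Word.run w r).map (pre ++ ·) := by
  induction w generalizing r with
  | nil => rfl
  | cons x w ih =>
    obtain ⟨i, p⟩ := x
    simp only [Word.shift_cons, Word.run, Piece.step_add]
    cases p.step i r with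
    | none => rfl
    | some s => exact ih s

lemma lockWord_run_cons (d : Locking) (o a b : Bool) (c : Colour) (r : List Bool) :
    Word.run (lockWord 0 d o c) (a :: b :: r) =
      if a = o ∧ b = !o then some (a :: b :: r) else none := by
  cases d <;> cases o <;> cases a <;> cases b <;> rfl

/-- This recovers the orientations at a lock from the mere fact that the diagram fits; the expansion
over resolutions needs them because the resolutions must fit in the same place. -/
lemma lockWord_run {k : ℕ} {d : Locking} {o : Bool} {c : Colour} {s s' : List Bool}
    (h : Word.run (lockWord k d o c) s = some s') :
    s' = s ∧ ∃ pre r, pre.length = k ∧ s = pre ++ o :: (!o) :: r := by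
  have hk : k ≤ s.length := by
    by_contra hlt
    -- With fewer than `k` strands below, a minimum in the lock fails to fit.
    have e : ∀ i, ¬ k + i ≤ s.length := fun i => by omega
    cases d <;> cases o <;>
      simp [lockWord, crossUpDown, crossDownUp, Word.run, Piece.step, e, hlt] at h
  obtain ⟨pre, r, rfl, rfl⟩ : ∃ pre r, pre.length = k ∧ s = pre ++ r :=
    ⟨s.take k, s.drop k, by simp [hk], (List.take_append_drop k s).symm⟩
  rw [lockWord_shift, Word.run_shift] at h
  obtain ⟨r', hr', rfl⟩ := Option.map_eq_some_iff.1 h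
  suffices r' = r ∧ ∃ r₀, r = o :: (!o) :: r₀ by
    obtain ⟨rfl, r₀, rfl⟩ := this
    exact ⟨rfl, pre, r₀, rfl, rfl⟩
  clear h hk
  rcases r with _ | ⟨a, _ | ⟨b, r⟩⟩
  · cases d <;> cases o <;> exact absurd hr' (by rw [show Word.run _ _ = none from rfl]; simp)
  · cases d <;> cases o <;> cases a <;>
      exact absurd hr' (by rw [show Word.run _ _ = none from rfl]; simp)
  · rw [lockWord_run_cons] at hr'
    split_ifs at hr' with hab
    obtain ⟨rfl, rfl⟩ := hab
    exact ⟨(Option.some.inj hr').symm, r, rfl⟩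

lemma unhooked_run (d : Locking) (o : Bool) (pre r : List Bool) :
    Word.run (unhooked pre.length d o) (pre ++ o :: (!o) :: r) =
      some (pre ++ o :: (!o) :: r) := by
  cases d <;> simp [unhooked, Word.run, Piece.step]

lemma smoothed_run (d : Locking) (o : Bool) (pre r : List Bool) :
    Word.run (smoothed pre.length d o) (pre ++ o :: (!o) :: r) =
      some (pre ++ o :: (!o) :: r) := by
  cases d <;> simp [smoothed, Word.run, Piece.step]

/-! ### The action on tensors -/

/-- The tensor `v` has `n` legs. -/
def Supported {N : ℕ} (n : ℕ) (v : List (Fin N) → ℤ[T;T⁻¹]) : Prop :=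
  ∀ l, l.length ≠ n → v l = 0

/-- Local identities hold only for colourings of the right length, because `take` and `drop` give
junk values otherwise. Support control makes both sides vanish elsewhere, so that identities of
functions follow. -/
lemma Piece.act_supported {N : ℕ} {v : List (Fin N) → ℤ[T;T⁻¹]} {s s' : List Bool} {k : ℕ}
    {p : Piece} (hv : Supported s.length v) (h : p.step k s = some s') :
    Supported s'.length (Piece.act N v (k, p)) := by
  intro l hl
  cases p with
  | cup o =>
    obtain ⟨pre, r, rfl, rfl, rfl⟩ := (Piece.step_cup_iff _ _ _ _).1 h
    simp only [Piece.act]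
    rcases hd : l.drop pre.length with _ | ⟨a, _ | ⟨b, r'⟩⟩
    · rfl
    · rfl
    · have h1 := congrArg List.length hd
      have h2 : pre.length ≤ l.length := by
        by_contra hlt
        rw [List.drop_of_length_le (by omega)] at hd
        simp at hd
      simp only [List.length_drop, List.length_cons, List.length_append] at h1 hl
      dsimp only
      split_ifs
      · rw [hv, mul_zero]
        simp only [List.length_append, List.length_take]
        omega
      · rfl
  | cap o =>
    obtain ⟨pre, r, rfl, rfl, rfl⟩ := (Piece.step_cap_iff _ _ _ _).1 h
    simp only [Piece.act]
    refine Finset.sum_eq_zero fun c _ => ?_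
    rw [hv, mul_zero]
    simp only [List.length_append, List.length_take, List.length_cons, List.length_drop] at hl ⊢
    omega
  | cross c =>
    obtain ⟨pre, r, rfl, rfl, rfl⟩ := (Piece.step_cross_iff _ _ _ _).1 h
    have key : ∀ a b (r' : List (Fin N)), l.drop pre.length = a :: b :: r' → ∀ x y,
        v (l.take pre.length ++ x :: y :: r') = 0 := by
      intro a b r' hd x y
      apply hv
      have h1 := congrArg List.length hd
      have h2 : pre.length ≤ l.length := by
        by_contra hlt
        rw [List.drop_of_length_le (by omega)] at hd
        simp at hd
      simp only [List.length_append, List.length_take, List.length_cons, List.length_drop]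
        at hl h1 ⊢
      omega
    cases c <;> simp only [Piece.act]
    all_goals
      rcases hd : l.drop pre.length with _ | ⟨a, _ | ⟨b, r'⟩⟩
      · rfl
      · rfl
      · refine Finset.sum_eq_zero fun x _ => Finset.sum_eq_zero fun y _ => ?_
        rw [key a b r' hd, mul_zero]

lemma Word.act_supported {N : ℕ} {v : List (Fin N) → ℤ[T;T⁻¹]} {s s' : List Bool} {w : Word}
    (hv : Supported s.length v) (h : w.run s = some s') :
    Supported s'.length (w.foldl (Piece.act N) v) := by
  induction w generalizing s v with
  | nil => obtain rfl := Option.some.inj h; exact hv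
  | cons x w ih =>
    obtain ⟨k, p⟩ := x
    obtain ⟨s1, h1, h2⟩ := Option.bind_eq_some_iff.1 h
    exact ih (Piece.act_supported hv h1) h2

lemma Piece.act_add_smul {N : ℕ} (v v' : List (Fin N) → ℤ[T;T⁻¹]) (z : ℤ[T;T⁻¹]) (x : ℕ × Piece) :
    Piece.act N (fun l => v l + z * v' l) x =
      fun l => Piece.act N v x l + z * Piece.act N v' x l := by
  funext l
  obtain ⟨k, o | o | c⟩ := x
  · simp only [Piece.act]
    rcases l.drop k with _ | ⟨a, _ | ⟨b, r'⟩⟩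
    · simp
    · simp
    · dsimp only
      split_ifs
      · ring
      · ring
  · simp only [Piece.act, Finset.mul_sum, ← Finset.sum_add_distrib]
    exact Finset.sum_congr rfl fun c _ => by ring
  · cases c <;> simp only [Piece.act]
    all_goals
      rcases l.drop k with _ | ⟨a, _ | ⟨b, r'⟩⟩
      · simp
      · simp
      · simp only [Finset.mul_sum, ← Finset.sum_add_distrib]
        exact Finset.sum_congr rfl fun c _ => Finset.sum_congr rfl fun d _ => by ring

lemma Word.act_add_smul {N : ℕ} (v v' : List (Fin N) → ℤ[T;T⁻¹]) (z : ℤ[T;T⁻¹]) (w : Word) :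
    w.foldl (Piece.act N) (fun l => v l + z * v' l) =
      fun l => w.foldl (Piece.act N) v l + z * w.foldl (Piece.act N) v' l := by
  induction w generalizing v v' with
  | nil => rfl
  | cons x w ih => simp only [List.foldl_cons, Piece.act_add_smul, ih]

lemma Word.act_zero {N : ℕ} (w : Word) :
    w.foldl (Piece.act N) (fun _ => 0) = fun _ => 0 := by
  have := Word.act_add_smul (N := N) (fun _ => 0) (fun _ => 0) (-1) w
  simpa using this

lemma Word.act_smul {N : ℕ} (v : List (Fin N) → ℤ[T;T⁻¹]) (z : ℤ[T;T⁻¹]) (w : Word) :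
    w.foldl (Piece.act N) (fun l => z * v l) = fun l => z * w.foldl (Piece.act N) v l := by
  have := Word.act_add_smul (fun _ => 0) v z w
  simpa [Word.act_zero] using this

lemma Piece.act_add {N : ℕ} (v : List (Fin N) → ℤ[T;T⁻¹]) (pre r : List (Fin N)) (i : ℕ)
    (p : Piece) :
    Piece.act N v (pre.length + i, p) (pre ++ r) =
      Piece.act N (fun r => v (pre ++ r)) (i, p) r := by
  cases p with
  | cup o =>
    simp only [Piece.act, List.take_length_add_append, List.drop_length_add_append,
      List.append_assoc]
  | cap o =>
    simp only [Piece.act, List.take_length_add_append, List.drop_length_add_append,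
      List.append_assoc]
  | cross c =>
    cases c <;> simp only [Piece.act, List.take_length_add_append, List.drop_length_add_append,
      List.append_assoc]

lemma Word.act_shift {N : ℕ} (v : List (Fin N) → ℤ[T;T⁻¹]) (pre r : List (Fin N)) (w : Word) :
    (Word.shift pre.length w).foldl (Piece.act N) v (pre ++ r) =
      w.foldl (Piece.act N) (fun r => v (pre ++ r)) r := by
  induction w generalizing v with
  | nil => rfl
  | cons x w ih =>
    obtain ⟨i, p⟩ := x
    simp only [Word.shift_cons, List.foldl_cons, ih, Piece.act_add]

/-! ### The R-matrix as a swap plus a triangular diagonal part, for both colours at once -/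

/-- The entry of the R-matrix of a crossing that interchanges the colours `a` and `b`. -/
def swapWeight (N : ℕ) (col : Colour) (a b : Fin N) : ℤ[T;T⁻¹] :=
  if a = b then (match col with | .black => T 1 | .white => T (-1)) else 1

/-- The order of the colours in which the R-matrix of a crossing is triangular. -/
def Colour.lt {N : ℕ} (col : Colour) (a b : Fin N) : Prop :=
  match col with
  | .black => a < b
  | .white => b < a

instance {N : ℕ} (col : Colour) : DecidableRel (col.lt (N := N)) := fun a b => by
  cases col <;> unfold Colour.lt <;> infer_instance

/-- `{q}` for a positive and `-{q}` for a negative crossing. -/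
def Colour.skein : Colour → ℤ[T;T⁻¹]
  | .black => bracket q₁
  | .white => -bracket q₁

/-- The entry of the R-matrix of a crossing that keeps the colours `a` and `b`. -/
def stayWeight (N : ℕ) (col : Colour) (a b : Fin N) : ℤ[T;T⁻¹] :=
  if col.lt a b then col.skein else 0

lemma rMatrix_eq {N : ℕ} (a b c d : Fin N) :
    rMatrix N a b c d =
      (if c = b then if d = a then swapWeight N .black a b else 0 else 0) +
        if c = a then if d = b then stayWeight N .black a b else 0 else 0 := by
  simp only [rMatrix, swapWeight, stayWeight, Colour.lt, Colour.skein, q₁]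
  by_cases hab : a = b
  · subst hab; simp; grind
  · grind

lemma rMatrixInv_eq {N : ℕ} (a b c d : Fin N) :
    rMatrixInv N a b c d =
      (if c = b then if d = a then swapWeight N .white a b else 0 else 0) +
        if c = a then if d = b then stayWeight N .white a b else 0 else 0 := by
  simp only [rMatrixInv, swapWeight, stayWeight, Colour.lt, Colour.skein, q₁]
  by_cases hab : a = b
  · subst hab; simp; grind
  · grind

lemma Piece.act_cross {N : ℕ} (v : List (Fin N) → ℤ[T;T⁻¹]) (k : ℕ) (col : Colour)
    (l : List (Fin N)) :
    Piece.act N v (k, .cross col) l =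
      match l.drop k with
      | a :: b :: r => swapWeight N col a b * v (l.take k ++ b :: a :: r) +
          stayWeight N col a b * v (l.take k ++ a :: b :: r)
      | _ => 0 := by
  cases col <;> simp only [Piece.act]
  all_goals
    rcases l.drop k with _ | ⟨a, _ | ⟨b, r⟩⟩
    · rfl
    · rfl
    · simp only [rMatrix_eq, rMatrixInv_eq, add_mul, ite_mul, zero_mul, Finset.sum_add_distrib,
        Finset.sum_ite_eq', Finset.mem_univ, if_true, Finset.sum_ite_irrel,
        Finset.sum_const_zero]

lemma Piece.act_cup {N : ℕ} (v : List (Fin N) → ℤ[T;T⁻¹]) (k : ℕ) (o : Bool)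
    (l : List (Fin N)) :
    Piece.act N v (k, .cup o) l =
      match l.drop k with
      | a :: b :: r => if a = b then cupWeight N o a * v (l.take k ++ r) else 0
      | _ => 0 := rfl

lemma Piece.act_cap {N : ℕ} (v : List (Fin N) → ℤ[T;T⁻¹]) (k : ℕ) (o : Bool)
    (l : List (Fin N)) :
    Piece.act N v (k, .cap o) l =
      ∑ c : Fin N, capWeight N o c * v (l.take k ++ c :: c :: l.drop k) := rfl

@[simp] lemma capWeight_false {N : ℕ} (c : Fin N) : capWeight N false c = 1 := rfl

@[simp] lemma cupWeight_true {N : ℕ} (c : Fin N) : cupWeight N true c = 1 := rfl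

lemma cap_mul_cup {N : ℕ} (c : Fin N) : capWeight N true c * cupWeight N false c = 1 := by
  simp only [capWeight, cupWeight, if_true, Bool.false_eq_true, if_false, ← T_add]
  rw [← T_zero]
  congr 1
  ring

lemma bracket_q₁ : bracket q₁ = T 1 - T (-1) := rfl

/-- The eigenvalue of the R-matrix of a crossing on two equal colours. -/
def Colour.diag : Colour → ℤ[T;T⁻¹]
  | .black => T 1
  | .white => T (-1)

/-- The value of a kink. -/
def Colour.kink (N : ℕ) : Colour → ℤ[T;T⁻¹]
  | .black => T N
  | .white => T (-N)

lemma swapWeight_self {N : ℕ} (col : Colour) (a : Fin N) : swapWeight N col a a = col.diag := by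
  cases col <;> simp [swapWeight, Colour.diag]

lemma swapWeight_ne {N : ℕ} (col : Colour) {a b : Fin N} (h : a ≠ b) :
    swapWeight N col a b = 1 := by
  simp [swapWeight, h]

/-- This is the Hecke relation on equal colours: `q` and `q⁻¹` are roots of `z^2 = 1 + {q} z` and
`z^2 = 1 - {q} z` respectively. -/
lemma Colour.diag_sq (col : Colour) : col.diag * col.diag = 1 + col.skein * col.diag := by
  have h : (T 1 * T (-1) : ℤ[T;T⁻¹]) = 1 := by rw [← T_add]; simp
  cases col <;> simp only [Colour.diag, Colour.skein, bracket_q₁] <;> linear_combination h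

lemma Colour.lt_irrefl {N : ℕ} (col : Colour) (a : Fin N) : ¬ col.lt a a := by
  cases col <;> simp [Colour.lt]

lemma Colour.lt_trichotomy {N : ℕ} (col : Colour) (a b : Fin N) :
    col.lt a b ∨ a = b ∨ col.lt b a := by
  cases col <;> simp only [Colour.lt]
  · exact _root_.lt_trichotomy a b
  · rcases _root_.lt_trichotomy a b with h | h | h <;> simp [h]

lemma Colour.lt_trans {N : ℕ} {col : Colour} {a b c : Fin N} (h : col.lt a b) (h' : col.lt b c) :
    col.lt a c := by
  cases col <;> simp only [Colour.lt] at *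
  · exact h.trans h'
  · exact h'.trans h

lemma stayWeight_black {N : ℕ} (a b : Fin N) :
    stayWeight N .black a b = if a < b then bracket q₁ else 0 := by
  by_cases h : a < b <;> simp [stayWeight, Colour.lt, Colour.skein, h]

lemma stayWeight_white {N : ℕ} (a b : Fin N) :
    stayWeight N .white a b = if b < a then -bracket q₁ else 0 := by
  by_cases h : b < a <;> simp [stayWeight, Colour.lt, Colour.skein, h]

lemma stayWeight_self {N : ℕ} (col : Colour) (a : Fin N) : stayWeight N col a a = 0 :=
  if_neg (col.lt_irrefl a)

lemma stayWeight_pos {N : ℕ} {col : Colour} {a b : Fin N} (h : col.lt a b) :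
    stayWeight N col a b = col.skein := if_pos h

lemma stayWeight_neg {N : ℕ} {col : Colour} {a b : Fin N} (h : col.lt b a) :
    stayWeight N col a b = 0 :=
  if_neg fun h' => col.lt_irrefl _ (Colour.lt_trans h h')

/-- Of the two order conditions on `y`, the one involving the smaller colour `a` implies the other,
so the second factor is constantly `col.skein` wherever the first is nonzero. -/
lemma stayWeight_mul_left {N : ℕ} {col : Colour} {a b : Fin N} (h : a = b ∨ col.lt a b)
    (y : Fin N) :
    stayWeight N col y a * stayWeight N col y b = col.skein * stayWeight N col y a := by
  unfold stayWeight
  by_cases hy : col.lt y a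
  · have hb : col.lt y b := by
      rcases h with rfl | h
      · exact hy
      · exact Colour.lt_trans hy h
    simp [hy, hb]
  · simp [hy]

lemma stayWeight_mul_right {N : ℕ} {col : Colour} {a b : Fin N} (h : a = b ∨ col.lt a b)
    (y : Fin N) :
    stayWeight N col a y * stayWeight N col b y = col.skein * stayWeight N col b y := by
  unfold stayWeight
  by_cases hy : col.lt b y
  · have hb : col.lt a y := by
      rcases h with rfl | h
      · exact hy
      · exact Colour.lt_trans h hy
    simp [hy, hb]
  · simp [hy]

/-! ### Telescoping sums over colours -/

lemma sum_Fin_lt {R : Type*} [CommRing R] (F : ℕ → R) {N : ℕ} (a : Fin N) :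
    ∑ y : Fin N, (if a < y then F (y + 1) - F y else 0) = F N - F (a + 1) := by
  have key : ∀ n, (a : ℕ) + 1 ≤ n →
      ∑ y ∈ Finset.range n, (if (a : ℕ) < y then F (y + 1) - F y else 0) = F n - F (a + 1) := by
    intro n hn
    induction n, hn using Nat.le_induction with
    | base =>
      rw [sub_self]
      refine Finset.sum_eq_zero fun y hy => if_neg ?_
      have := Finset.mem_range.1 hy
      omega
    | succ n hn ih =>
      rw [Finset.sum_range_succ, ih, if_pos (by omega)]
      ring
  rw [← key N a.2, ← Fin.sum_univ_eq_sum_range]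
  rfl

lemma sum_Fin_gt {R : Type*} [CommRing R] (F : ℕ → R) {N : ℕ} (a : Fin N) :
    ∑ y : Fin N, (if y < a then F (y + 1) - F y else 0) = F a - F 0 := by
  have h := Finset.sum_range_sub F N
  rw [← Fin.sum_univ_eq_sum_range (fun i => F (i + 1) - F i)] at h
  have h2 := sum_Fin_lt F a
  have h3 : ∑ y : Fin N, (if y = a then F (y + 1) - F y else 0) = F (a + 1) - F a := by simp
  have h4 : ∑ y : Fin N, (F (y + 1) - F y) =
      ∑ y : Fin N, (if y < a then F (y + 1) - F y else 0) +
      ∑ y : Fin N, (if y = a then F (y + 1) - F y else 0) +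
      ∑ y : Fin N, (if a < y then F (y + 1) - F y else 0) := by
    rw [← Finset.sum_add_distrib, ← Finset.sum_add_distrib]
    refine Finset.sum_congr rfl fun y _ => ?_
    rcases lt_trichotomy y a with h | h | h
    · simp [h, h.ne, h.le]
    · simp [h]
    · simp [h, h.ne', h.le]
  rw [h2, h3, h] at h4
  linear_combination -h4

/-- After moving `diag * capWeight N true a` to the left, this evaluates a kink: the result does not
depend on the colour `a`. The factor `{q}` turns each weight into a difference of consecutive powers
`T (2 * i - N)`. -/
lemma sum_stay_cap {N : ℕ} (col : Colour) (a : Fin N) :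
    ∑ y : Fin N, stayWeight N col a y * capWeight N true y =
      col.kink N - col.diag * capWeight N true a := by
  have e : ∀ y : Fin N, bracket q₁ * capWeight N true y =
      (fun i : ℕ => (T (2 * (i : ℤ) - N) : ℤ[T;T⁻¹])) (y + 1) -
        (fun i : ℕ => (T (2 * (i : ℤ) - N) : ℤ[T;T⁻¹])) y := by
    intro y
    simp only [bracket_q₁, capWeight, if_true, sub_mul, ← T_add]
    congr 2 <;> push_cast <;> ring
  cases col
  · have h := sum_Fin_lt (fun i : ℕ => (T (2 * (i : ℤ) - N) : ℤ[T;T⁻¹])) a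
    simp only [← e] at h
    simp only [stayWeight_black, stayWeight_white, ite_mul, zero_mul, Colour.kink, Colour.diag]
    refine h.trans ?_
    simp only [capWeight, if_true, ← T_add]
    congr 2 <;> push_cast <;> ring
  · have h := sum_Fin_gt (fun i : ℕ => (T (2 * (i : ℤ) - N) : ℤ[T;T⁻¹])) a
    simp only [← e] at h
    simp only [stayWeight_black, stayWeight_white, ite_mul, zero_mul, Colour.kink, Colour.diag,
      neg_mul]
    have h' := congrArg (fun z => -z) h
    simp only [← Finset.sum_neg_distrib, apply_ite (fun z : ℤ[T;T⁻¹] => -z), neg_zero] at h'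
    refine h'.trans ?_
    simp only [capWeight, if_true, ← T_add, neg_sub]
    congr 2 <;> push_cast <;> ring

lemma sum_stay_cup {N : ℕ} (col : Colour) (a : Fin N) :
    ∑ y : Fin N, stayWeight N col y a * cupWeight N false y =
      col.kink N - col.diag * cupWeight N false a := by
  have e : ∀ y : Fin N, bracket q₁ * cupWeight N false y =
      (fun i : ℕ => (-T (N - 2 * (i : ℤ)) : ℤ[T;T⁻¹])) (y + 1) -
        (fun i : ℕ => (-T (N - 2 * (i : ℤ)) : ℤ[T;T⁻¹])) y := by
    intro y
    simp only [bracket_q₁, cupWeight, Bool.false_eq_true, if_false, sub_mul, ← T_add]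
    rw [neg_sub_neg]
    congr 2 <;> push_cast <;> ring
  cases col
  · have h := sum_Fin_gt (fun i : ℕ => (-T (N - 2 * (i : ℤ)) : ℤ[T;T⁻¹])) a
    simp only [← e] at h
    simp only [stayWeight_black, stayWeight_white, ite_mul, zero_mul, Colour.kink, Colour.diag]
    refine h.trans ?_
    simp only [cupWeight, Bool.false_eq_true, if_false, ← T_add]
    rw [neg_sub_neg]
    congr 2
    ring
  · have h := sum_Fin_lt (fun i : ℕ => (-T (N - 2 * (i : ℤ)) : ℤ[T;T⁻¹])) a
    simp only [← e] at h
    simp only [stayWeight_black, stayWeight_white, ite_mul, zero_mul, Colour.kink, Colour.diag,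
      neg_mul]
    have h' := congrArg (fun z => -z) h
    simp only [← Finset.sum_neg_distrib, apply_ite (fun z : ℤ[T;T⁻¹] => -z), neg_zero] at h'
    refine h'.trans ?_
    simp only [cupWeight, Bool.false_eq_true, if_false, ← T_add]
    rw [neg_sub_neg, neg_sub]
    congr 2
    · ring
    · push_cast; ring

/-- A product of two triangular entries collapses to one by `stayWeight_mul_right`, which reduces
the sum over the colour between the two crossings to a single kink. -/
lemma sum_stay_stay_cap {N : ℕ} {col : Colour} {a b : Fin N} (h : a = b ∨ col.lt a b) :
    ∑ y : Fin N, stayWeight N col a y * stayWeight N col b y * capWeight N true y =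
      col.skein * (col.kink N - col.diag * capWeight N true b) := by
  simp only [stayWeight_mul_right h, ← sum_stay_cap, Finset.mul_sum, mul_assoc]

lemma sum_stay_stay_cup {N : ℕ} {col : Colour} {a b : Fin N} (h : a = b ∨ col.lt a b) :
    ∑ y : Fin N, stayWeight N col y a * stayWeight N col y b * cupWeight N false y =
      col.skein * (col.kink N - col.diag * cupWeight N false a) := by
  simp only [stayWeight_mul_left h, ← sum_stay_cup, Finset.mul_sum, mul_assoc]

/-! ### The local identity for locks -/

/-- For different end colours only the term with two swaps survives, giving the identity. For equal
end colours the coefficients of `v (x :: x :: r)` are compared for each `x`. -/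
lemma act_lock_horizontal_true {N : ℕ} (v : List (Fin N) → ℤ[T;T⁻¹]) (a b : Fin N)
    (r : List (Fin N)) (col : Colour) :
    (lockWord 0 .horizontal true col).foldl (Piece.act N) v (a :: b :: r) =
      v (a :: b :: r) + col.skein * col.kink N *
        (smoothed 0 .horizontal true).foldl (Piece.act N) v (a :: b :: r) := by
  simp only [lockWord, smoothed, crossUpDown, crossDownUp, List.cons_append, List.nil_append,
    List.foldl_cons, List.foldl_nil, Piece.act_cross, Piece.act_cup, Piece.act_cap,
    List.drop_zero, List.take_zero, zero_add, List.drop_succ_cons, List.take_succ_cons,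
    capWeight_false, cupWeight_true, one_mul]
  simp only [mul_add, add_mul, mul_ite, ite_mul, mul_zero, zero_mul, Finset.sum_add_distrib,
    Finset.sum_ite_eq, Finset.sum_ite_eq', Finset.mem_univ, if_true, ite_self,
    Finset.sum_ite_irrel, Finset.sum_const_zero]
  by_cases hab : a = b
  · subst hab
    simp only [if_true, swapWeight_self]
    -- The isolated terms at colour `a` are written as sums over `x`, so that the whole identity can
    -- be checked summand by summand.
    have h1 : ∀ u : Fin N → ℤ[T;T⁻¹], u a = ∑ x, if x = a then u x else 0 := by simp
    have h2 : ∑ x, stayWeight N col x a * ∑ y, capWeight N true y *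
        (stayWeight N col x y * (cupWeight N false x * v (y :: y :: r))) =
        ∑ y, (∑ x, stayWeight N col x a * stayWeight N col x y * cupWeight N false x) *
          capWeight N true y * v (y :: y :: r) := by
      simp only [Finset.mul_sum, Finset.sum_mul]
      rw [Finset.sum_comm]
      exact Finset.sum_congr rfl fun _ _ => Finset.sum_congr rfl fun _ _ => by ring
    rw [h2, h1 fun x => col.diag * (capWeight N true x *
      (col.diag * (cupWeight N false x * v (x :: x :: r)))), h1 fun x => v (x :: x :: r)]
    simp only [Finset.mul_sum, ← Finset.sum_add_distrib]
    refine Finset.sum_congr rfl fun x _ => ?_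
    have hx := cap_mul_cup x
    have ha := cap_mul_cup a
    have hz := col.diag_sq
    -- For `x ≠ a` the only surviving term with one swap and one stay cancels the `diag` part of the
    -- double-stay sum, leaving `skein * kink`. For `x = a` there is no such term, and `diag_sq`
    -- reduces the double swap minus that `diag` part to the identity.
    rcases col.lt_trichotomy a x with h | rfl | h
    · rw [sum_stay_stay_cup (Or.inr h), stayWeight_pos h, stayWeight_neg h,
        if_neg (by rintro rfl; exact col.lt_irrefl _ h), if_neg (by rintro rfl; exact col.lt_irrefl _ h)]
      ring
    · simp only [sum_stay_stay_cup (Or.inl rfl), stayWeight_self, if_true]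
      linear_combination (col.diag * col.diag * v (a :: a :: r) - col.skein * col.diag * v (a :: a :: r)) * ha + v (a :: a :: r) * hz
    · simp only [mul_comm (stayWeight N col _ a) (stayWeight N col _ x)]
      rw [sum_stay_stay_cup (Or.inr h), stayWeight_pos h, stayWeight_neg h,
        if_neg (by rintro rfl; exact col.lt_irrefl _ h), if_neg (by rintro rfl; exact col.lt_irrefl _ h)]
      ring_nf
  · simp only [hab, Ne.symm hab, if_false, swapWeight_ne col hab, swapWeight_ne col (Ne.symm hab)]
    linear_combination v (a :: b :: r) * cap_mul_cup b

lemma act_lock_horizontal_false {N : ℕ} (v : List (Fin N) → ℤ[T;T⁻¹]) (a b : Fin N)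
    (r : List (Fin N)) (col : Colour) :
    (lockWord 0 .horizontal false col).foldl (Piece.act N) v (a :: b :: r) =
      v (a :: b :: r) + col.skein * col.kink N *
        (smoothed 0 .horizontal false).foldl (Piece.act N) v (a :: b :: r) := by
  simp only [lockWord, smoothed, crossUpDown, crossDownUp, List.cons_append, List.nil_append,
    List.foldl_cons, List.foldl_nil, Piece.act_cross, Piece.act_cup, Piece.act_cap,
    List.drop_zero, List.take_zero, zero_add, List.drop_succ_cons, List.take_succ_cons,
    capWeight_false, cupWeight_true, one_mul]
  simp only [mul_add, add_mul, mul_ite, ite_mul, mul_zero, zero_mul, Finset.sum_add_distrib,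
    Finset.sum_ite_eq, Finset.sum_ite_eq', Finset.mem_univ, if_true, ite_self,
    Finset.sum_ite_irrel, Finset.sum_const_zero]
  by_cases hab : a = b
  · subst hab
    simp only [if_true, swapWeight_self]
    have h1 : ∀ u : Fin N → ℤ[T;T⁻¹], u a = ∑ x, if x = a then u x else 0 := by simp
    have h2 : ∑ x, capWeight N true x * (stayWeight N col a x * (cupWeight N false a *
          ∑ y, stayWeight N col y x * v (y :: y :: r))) =
        ∑ y, (∑ x, stayWeight N col a x * stayWeight N col y x * capWeight N true x) *
          cupWeight N false a * v (y :: y :: r) := by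
      simp only [Finset.mul_sum, Finset.sum_mul]
      rw [Finset.sum_comm]
      exact Finset.sum_congr rfl fun _ _ => Finset.sum_congr rfl fun _ _ => by ring
    rw [h2, h1 fun x => capWeight N true x * (col.diag * (cupWeight N false x *
      (col.diag * v (x :: x :: r)))), h1 fun x => v (x :: x :: r)]
    simp only [Finset.mul_sum, ← Finset.sum_add_distrib]
    refine Finset.sum_congr rfl fun x _ => ?_
    have ha := cap_mul_cup a
    have hz := col.diag_sq
    rcases col.lt_trichotomy a x with h | rfl | h
    · rw [sum_stay_stay_cap (Or.inr h), stayWeight_pos h, stayWeight_neg h,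
        if_neg (by rintro rfl; exact col.lt_irrefl _ h),
        if_neg (by rintro rfl; exact col.lt_irrefl _ h)]
      ring
    · simp only [sum_stay_stay_cap (Or.inl rfl), stayWeight_self, if_true]
      linear_combination (col.diag * col.diag * v (a :: a :: r) -
        col.skein * col.diag * v (a :: a :: r)) * ha + v (a :: a :: r) * hz
    · simp only [mul_comm (stayWeight N col a _) (stayWeight N col x _)]
      rw [sum_stay_stay_cap (Or.inr h), stayWeight_pos h, stayWeight_neg h,
        if_neg (by rintro rfl; exact col.lt_irrefl _ h),
        if_neg (by rintro rfl; exact col.lt_irrefl _ h)]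
      ring
  · simp only [hab, Ne.symm hab, if_false, swapWeight_ne col hab, swapWeight_ne col (Ne.symm hab)]
    linear_combination v (a :: b :: r) * cap_mul_cup a

/-- The double swaps produce the unhooked arcs and the double stays produce `skein * kink` times the
identity. The error terms, both of the form `skein * diag * capWeight`, cancel. -/
lemma act_lock_vertical_true {N : ℕ} (v : List (Fin N) → ℤ[T;T⁻¹]) (a b : Fin N)
    (r : List (Fin N)) (col : Colour) :
    (lockWord 0 .vertical true col).foldl (Piece.act N) v (a :: b :: r) =
      (unhooked 0 .vertical true).foldl (Piece.act N) v (a :: b :: r) +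
        col.skein * col.kink N * v (a :: b :: r) := by
  simp only [lockWord, unhooked, crossDown, List.cons_append, List.nil_append,
    List.foldl_cons, List.foldl_nil, Piece.act_cross, Piece.act_cup, Piece.act_cap,
    List.drop_zero, List.take_zero, zero_add, List.drop_succ_cons, List.take_succ_cons,
    capWeight_false, cupWeight_true, one_mul]
  simp only [mul_add, add_mul, mul_ite, ite_mul, mul_zero, zero_mul, Finset.sum_add_distrib,
    Finset.sum_ite_eq, Finset.sum_ite_eq', Finset.mem_univ, if_true, ite_self,
    Finset.sum_ite_irrel, Finset.sum_const_zero]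
  by_cases hab : a = b
  · subst hab
    simp only [if_true, swapWeight_self]
    -- The double swap has coefficient 1 except at `x = a`, where it is `diag ^ 2`; the excess
    -- `skein * diag` is split off.
    have h1 : ∑ x, capWeight N true x * (swapWeight N col x a * (swapWeight N col a x *
          v (x :: x :: r))) =
        ∑ x, capWeight N true x * v (x :: x :: r) + col.skein * col.diag * capWeight N true a * v (a :: a :: r) := by
      have h3 : col.skein * col.diag * capWeight N true a * v (a :: a :: r) =
          ∑ x, if x = a then col.skein * col.diag * capWeight N true x * v (x :: x :: r) else 0 := by
        simp
      rw [h3, ← Finset.sum_add_distrib]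
      refine Finset.sum_congr rfl fun x _ => ?_
      by_cases hx : x = a
      · subst hx
        rw [swapWeight_self, if_pos rfl]
        linear_combination capWeight N true x * v (x :: x :: r) * col.diag_sq
      · rw [swapWeight_ne col hx, swapWeight_ne col (Ne.symm hx), if_neg hx]
        ring
    have h2 := sum_stay_stay_cap (N := N) (col := col) (a := a) (Or.inl rfl)
    have h4 := congrArg (· * v (a :: a :: r)) h2
    simp only [Finset.sum_mul] at h4
    have h5 : ∑ x, capWeight N true x * (stayWeight N col a x * (stayWeight N col a x *
          v (a :: a :: r))) = _ := (Finset.sum_congr rfl fun x _ => by ring).trans h4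
    rw [h1, h5, stayWeight_self]
    ring
  · simp only [hab, Ne.symm hab, if_false, swapWeight_self]
    -- The unhooked term vanishes for `a ≠ b`; which of the two mixed terms cancels the `diag` part
    -- depends on the order of the colours.
    rcases col.lt_trichotomy a b with h | h | h
    · have h2 := congrArg (· * v (a :: b :: r)) (sum_stay_stay_cap (Or.inr h))
      simp only [Finset.sum_mul] at h2
      have h5 : ∑ x, capWeight N true x * (stayWeight N col b x * (stayWeight N col a x *
          v (a :: b :: r))) = _ :=
        (Finset.sum_congr rfl fun x _ => by ring).trans h2
      rw [h5, stayWeight_pos h, stayWeight_neg h]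
      ring
    · exact absurd h hab
    · have h2 := congrArg (· * v (a :: b :: r)) (sum_stay_stay_cap (Or.inr h))
      simp only [Finset.sum_mul] at h2
      have h5 : ∑ x, capWeight N true x * (stayWeight N col b x * (stayWeight N col a x *
          v (a :: b :: r))) = _ :=
        (Finset.sum_congr rfl fun x _ => by ring).trans h2
      rw [h5, stayWeight_pos h, stayWeight_neg h]
      ring

lemma act_lock_vertical_false {N : ℕ} (v : List (Fin N) → ℤ[T;T⁻¹]) (a b : Fin N)
    (r : List (Fin N)) (col : Colour) :
    (lockWord 0 .vertical false col).foldl (Piece.act N) v (a :: b :: r) =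
      (unhooked 0 .vertical false).foldl (Piece.act N) v (a :: b :: r) +
        col.skein * col.kink N * v (a :: b :: r) := by
  simp only [lockWord, unhooked, crossDown, List.cons_append, List.nil_append,
    List.foldl_cons, List.foldl_nil, Piece.act_cross, Piece.act_cup, Piece.act_cap,
    List.drop_zero, List.take_zero, zero_add, List.drop_succ_cons, List.take_succ_cons,
    capWeight_false, cupWeight_true, one_mul]
  simp only [mul_add, add_mul, mul_ite, ite_mul, mul_zero, zero_mul, Finset.sum_add_distrib,
    Finset.sum_ite_eq, Finset.sum_ite_eq', Finset.mem_univ, if_true, ite_self,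
    Finset.sum_ite_irrel, Finset.sum_const_zero]
  by_cases hab : a = b
  · subst hab
    simp only [if_true, swapWeight_self]
    have h1 : ∑ x, swapWeight N col x a * (swapWeight N col a x * (cupWeight N false a *
          v (x :: x :: r))) =
        ∑ x, cupWeight N false a * v (x :: x :: r) + col.skein * col.diag * cupWeight N false a * v (a :: a :: r) := by
      have h3 : col.skein * col.diag * cupWeight N false a * v (a :: a :: r) =
          ∑ x, if x = a then col.skein * col.diag * cupWeight N false x * v (x :: x :: r) else 0 := by
        simp
      rw [h3, ← Finset.sum_add_distrib]
      refine Finset.sum_congr rfl fun x _ => ?_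
      by_cases hx : x = a
      · subst hx
        rw [swapWeight_self, if_pos rfl]
        linear_combination cupWeight N false x * v (x :: x :: r) * col.diag_sq
      · rw [swapWeight_ne col hx, swapWeight_ne col (Ne.symm hx), if_neg hx]
        ring
    have h2 := sum_stay_stay_cup (N := N) (col := col) (a := a) (Or.inl rfl)
    have h4 := congrArg (· * v (a :: a :: r)) h2
    simp only [Finset.sum_mul] at h4
    have h5 : ∑ x, stayWeight N col x a * (stayWeight N col x a * (cupWeight N false x *
          v (a :: a :: r))) = _ := (Finset.sum_congr rfl fun x _ => by ring).trans h4
    rw [h1, h5, stayWeight_self, Finset.mul_sum]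
    ring
  · simp only [hab, Ne.symm hab, if_false, swapWeight_self]
    rcases col.lt_trichotomy a b with h | h | h
    · have h2 := congrArg (· * v (a :: b :: r)) (sum_stay_stay_cup (Or.inr h))
      simp only [Finset.sum_mul] at h2
      have h5 : ∑ x, stayWeight N col x b * (stayWeight N col x a * (cupWeight N false x *
          v (a :: b :: r))) = _ :=
        (Finset.sum_congr rfl fun x _ => by ring).trans h2
      rw [h5, stayWeight_pos h, stayWeight_neg h]
      ring
    · exact absurd h hab
    · have h2 := congrArg (· * v (a :: b :: r)) (sum_stay_stay_cup (Or.inr h))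
      simp only [Finset.sum_mul] at h2
      have h5 : ∑ x, stayWeight N col x b * (stayWeight N col x a * (cupWeight N false x *
          v (a :: b :: r))) = _ :=
        (Finset.sum_congr rfl fun x _ => by ring).trans h2
      rw [h5, stayWeight_pos h, stayWeight_neg h]
      ring

lemma Word.act_lock {N : ℕ} {v : List (Fin N) → ℤ[T;T⁻¹]} {pre r : List Bool} {o : Bool} {k : ℕ}
    (hk : pre.length = k) (hv : Supported (pre ++ o :: (!o) :: r).length v) (d : Locking)
    (col : Colour) :
    (lockWord k d o col).foldl (Piece.act N) v =
      fun l => (unhooked k d o).foldl (Piece.act N) v l +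
        col.skein * col.kink N * (smoothed k d o).foldl (Piece.act N) v l := by
  subst hk
  have hrun : Word.run (lockWord pre.length d o col) (pre ++ o :: (!o) :: r) =
      some (pre ++ o :: (!o) :: r) := by
    rw [lockWord_shift, Word.run_shift, lockWord_run_cons]
    simp
  funext l
  by_cases hl : l.length = (pre ++ o :: (!o) :: r).length
  · simp only [List.length_append, List.length_cons] at hl
    obtain ⟨pre', r', hp, rfl⟩ : ∃ p q, p.length = pre.length ∧ l = p ++ q :=
      ⟨l.take pre.length, l.drop pre.length, by simp [hl], (List.take_append_drop _ l).symm⟩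
    obtain ⟨a, b, r', rfl⟩ : ∃ a b r'', r' = a :: b :: r'' := by
      rcases r' with _ | ⟨a, _ | ⟨b, r'⟩⟩
      · simp at hl; omega
      · simp at hl; omega
      · exact ⟨a, b, r', rfl⟩
    rw [← hp, lockWord_shift, unhooked_shift, smoothed_shift, Word.act_shift, Word.act_shift,
      Word.act_shift]
    cases d <;> cases o
    · exact act_lock_vertical_false _ _ _ _ _
    · exact act_lock_vertical_true _ _ _ _ _
    · exact act_lock_horizontal_false _ _ _ _ _
    · exact act_lock_horizontal_true _ _ _ _ _
  · rw [Word.act_supported hv hrun l hl, Word.act_supported hv (unhooked_run d o pre r) l hl,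
      Word.act_supported hv (smoothed_run d o pre r) l hl, mul_zero, add_zero]

/-! ### Resolutions -/

lemma BWord.resolutions_run {B : BWord} {s s' : List Bool} (h : B.link.run s = some s')
    {ρ : Resolution} (hρ : ρ ∈ B.resolutions) : ρ.cycles.run s = some s' := by
  induction B generalizing s ρ with
  | nil =>
    simp only [BWord.resolutions, List.mem_singleton] at hρ
    subst hρ
    exact h
  | cons x B ih =>
    obtain ⟨k, o | o | ⟨d, o, c⟩⟩ := x
    · obtain ⟨s1, h1, h2⟩ := Option.bind_eq_some_iff.1 h
      simp only [BWord.resolutions, List.mem_map] at hρ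
      obtain ⟨ρ, hρ, rfl⟩ := hρ
      exact Option.bind_eq_some_iff.2 ⟨s1, h1, ih h2 hρ⟩
    · obtain ⟨s1, h1, h2⟩ := Option.bind_eq_some_iff.1 h
      simp only [BWord.resolutions, List.mem_map] at hρ
      obtain ⟨ρ, hρ, rfl⟩ := hρ
      exact Option.bind_eq_some_iff.2 ⟨s1, h1, ih h2 hρ⟩
    · simp only [BWord.link, Word.run_append] at h
      obtain ⟨s1, h1, h2⟩ := Option.bind_eq_some_iff.1 h
      obtain ⟨rfl, pre, r, rfl, rfl⟩ := lockWord_run h1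
      simp only [BWord.resolutions, List.mem_append, List.mem_map] at hρ
      rcases hρ with ⟨ρ, hρ, rfl⟩ | ⟨ρ, hρ, rfl⟩
      · dsimp only
        rw [Word.run_append, unhooked_run]
        exact ih h2 hρ
      · cases c
        all_goals
          dsimp only
          rw [Word.run_append, smoothed_run]
          exact ih h2 hρ

/-- A diagram without crossings. -/
def Word.Planar (w : Word) : Prop := ∀ k c, (k, Piece.cross c) ∉ w

lemma BWord.resolutions_planar {B : BWord} {ρ : Resolution} (hρ : ρ ∈ B.resolutions) :
    ρ.cycles.Planar := by
  induction B generalizing ρ with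
  | nil =>
    simp only [BWord.resolutions, List.mem_singleton] at hρ
    subst hρ
    simp [Word.Planar]
  | cons x B ih =>
    obtain ⟨k, o | o | ⟨d, o, c⟩⟩ := x <;>
      simp only [BWord.resolutions, List.mem_append, List.mem_map] at hρ
    · obtain ⟨ρ, hρ, rfl⟩ := hρ
      simpa [Word.Planar] using ih hρ
    · obtain ⟨ρ, hρ, rfl⟩ := hρ
      simpa [Word.Planar] using ih hρ
    · rcases hρ with ⟨ρ, hρ, rfl⟩ | ⟨ρ, hρ, rfl⟩
      · cases d <;> simpa [Word.Planar, unhooked] using ih hρ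
      · cases c <;> cases d <;> simpa [Word.Planar, smoothed] using ih hρ

/-- An unhooked horizontal or a smoothed vertical lock is the empty word, but a diagram cannot begin
with a lock, having no strands below. This guarantees at least one cycle in every resolution. -/
lemma BWord.resolutions_ne_nil {B : BWord} {s' : List Bool} (h : B.link.run [] = some s')
    (hB : B ≠ []) {ρ : Resolution} (hρ : ρ ∈ B.resolutions) : ρ.cycles ≠ [] := by
  rcases B with _ | ⟨⟨k, o | o | ⟨d, o, c⟩⟩, B⟩
  · exact absurd rfl hB
  · simp only [BWord.resolutions, List.mem_map] at hρ
    obtain ⟨ρ, -, rfl⟩ := hρ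
    simp
  · simp only [BWord.resolutions, List.mem_map] at hρ
    obtain ⟨ρ, -, rfl⟩ := hρ
    simp
  · simp only [BWord.link, Word.run_append] at h
    obtain ⟨s1, h1, -⟩ := Option.bind_eq_some_iff.1 h
    obtain ⟨-, pre, r, -, hs⟩ := lockWord_run h1
    simp at hs

lemma BWord.act_link {N : ℕ} {B : BWord} {s s' : List Bool} {v : List (Fin N) → ℤ[T;T⁻¹]}
    (hv : Supported s.length v) (h : B.link.run s = some s') :
    B.link.foldl (Piece.act N) v = fun l => (B.resolutions.map fun ρ =>
      (Colour.black.skein * Colour.black.kink N) ^ ρ.b *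
      (Colour.white.skein * Colour.white.kink N) ^ ρ.c *
      ρ.cycles.foldl (Piece.act N) v l).sum := by
  induction B generalizing s v with
  | nil => simp [BWord.link, BWord.resolutions]
  | cons x B ih =>
    obtain ⟨k, o | o | ⟨d, o, c⟩⟩ := x
    · obtain ⟨s1, h1, h2⟩ := Option.bind_eq_some_iff.1 h
      simp only [BWord.link, List.foldl_cons, ih (Piece.act_supported hv h1) h2,
        BWord.resolutions, List.map_map, Function.comp_def]
    · obtain ⟨s1, h1, h2⟩ := Option.bind_eq_some_iff.1 h
      simp only [BWord.link, List.foldl_cons, ih (Piece.act_supported hv h1) h2,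
        BWord.resolutions, List.map_map, Function.comp_def]
    · simp only [BWord.link, Word.run_append] at h
      obtain ⟨s1, h1, h2⟩ := Option.bind_eq_some_iff.1 h
      obtain ⟨rfl, pre, r, hk, rfl⟩ := lockWord_run h1
      have hu := hk ▸ Word.act_supported hv (unhooked_run d o pre r)
      have hs := hk ▸ Word.act_supported hv (smoothed_run d o pre r)
      simp only [BWord.link, List.foldl_append, Word.act_lock hk hv, Word.act_add_smul,
        ih hu h2, ih hs h2, BWord.resolutions, List.map_append, List.sum_append, List.map_map,
        Function.comp_def]
      funext l
      congr 1
      rw [← List.sum_map_mul_left]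
      congr 1
      refine List.map_congr_left fun ρ _ => ?_
      cases c <;> simp only [List.foldl_append] <;> ring

/-! ### Cycle counts of the resolutions -/

lemma Trace.length_step {t : Trace} {s s' : List Bool} {k : ℕ} {p : Piece}
    (ht : t.labels.length = s.length) (h : p.step k s = some s') :
    (t.step (k, p)).labels.length = s'.length := by
  obtain ⟨L, n, c⟩ := t
  dsimp only at ht
  cases p with
  | cup o =>
    obtain ⟨pre, r, rfl, rfl, rfl⟩ := (Piece.step_cup_iff _ _ _ _).1 h
    simp only [List.length_append] at ht
    simp only [Trace.step, List.length_append, List.length_take, List.length_cons,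
      List.length_drop]
    omega
  | cap o =>
    obtain ⟨pre, r, rfl, rfl, rfl⟩ := (Piece.step_cap_iff _ _ _ _).1 h
    simp only [List.length_append, List.length_cons] at ht
    simp only [Trace.step]
    rcases hd : L.drop pre.length with _ | ⟨a, _ | ⟨b, r'⟩⟩ <;> have h1 := congrArg List.length hd <;>
      simp only [List.length_drop, List.length_cons, List.length_nil] at h1
    · omega
    · omega
    · dsimp only
      split_ifs <;> simp only [List.length_map, List.length_append, List.length_take] <;> omega
  | cross c =>
    obtain ⟨pre, r, rfl, rfl, rfl⟩ := (Piece.step_cross_iff _ _ _ _).1 h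
    simp only [List.length_append, List.length_cons] at ht
    simp only [Trace.step]
    rcases hd : L.drop pre.length with _ | ⟨a, _ | ⟨b, r'⟩⟩ <;> have h1 := congrArg List.length hd <;>
      simp only [List.length_drop, List.length_cons, List.length_nil] at h1
    · omega
    · omega
    · simp only [List.length_append, List.length_take, List.length_cons]
      omega

lemma Trace.length_foldl {t : Trace} {s s' : List Bool} {w : Word}
    (ht : t.labels.length = s.length) (h : w.run s = some s') :
    (w.foldl Trace.step t).labels.length = s'.length := by
  induction w generalizing s t with
  | nil => obtain rfl := Option.some.inj h; exact ht
  | cons x w ih =>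
    obtain ⟨k, p⟩ := x
    obtain ⟨s1, h1, h2⟩ := Option.bind_eq_some_iff.1 h
    exact ih (Trace.length_step ht h1) h2

lemma Trace.exists_split {t : Trace} {pre r : List Bool} {a b : Bool}
    (ht : t.labels.length = (pre ++ a :: b :: r).length) :
    ∃ pre' x y r', pre'.length = pre.length ∧ t = ⟨pre' ++ x :: y :: r', t.fresh, t.closed⟩ := by
  obtain ⟨L, n, c⟩ := t
  simp only [List.length_append, List.length_cons] at ht
  refine ⟨L.take pre.length, ?_⟩
  rcases hd : L.drop pre.length with _ | ⟨x, _ | ⟨y, r'⟩⟩ <;> have h1 := congrArg List.length hd <;>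
    simp only [List.length_drop, List.length_cons, List.length_nil] at h1
  · omega
  · omega
  · refine ⟨x, y, r', by simp; omega, ?_⟩
    rw [← hd, List.take_append_drop]

lemma Trace.count_unhooked_smoothed {t : Trace} {pre r : List Bool} {a b : Bool} {k : ℕ}
    (hv : t.Valid) (ht : t.labels.length = (pre ++ a :: b :: r).length) (hk : pre.length = k)
    (d : Locking) (o : Bool) (c : Colour) (w : Word) :
    t.count (lockWord k d o c ++ w) = t.count (unhooked k d o ++ w) ∧
    t.count (smoothed k d o ++ w) ≤ t.count (unhooked k d o ++ w) + 1 := by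
  obtain ⟨pre', x, y, r', hp, ht'⟩ := Trace.exists_split ht
  rw [ht'] at hv ⊢
  refine ⟨Trace.count_lock hv (hp.trans hk) d o c w, ?_⟩
  have := Trace.count_cap_cup hv (hp.trans hk) o w
  cases d
  · exact this.1
  · exact this.2

/-- Going up through the diagram, an unhooked lock costs nothing and a smoothed one at most one
extra component. -/
lemma BWord.count_resolution_le {B : BWord} {s s' : List Bool} {t : Trace} (hv : t.Valid)
    (ht : t.labels.length = s.length) (h : B.link.run s = some s') {ρ : Resolution}
    (hρ : ρ ∈ B.resolutions) : t.count ρ.cycles ≤ t.count B.link + ρ.b + ρ.c := by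
  induction B generalizing s t ρ with
  | nil =>
    simp only [BWord.resolutions, List.mem_singleton] at hρ
    subst hρ
    simp [BWord.link]
  | cons x B ih =>
    obtain ⟨k, o | o | ⟨d, o, c⟩⟩ := x
    · obtain ⟨s1, h1, h2⟩ := Option.bind_eq_some_iff.1 h
      simp only [BWord.resolutions, List.mem_map] at hρ
      obtain ⟨ρ, hρ, rfl⟩ := hρ
      exact ih (hv.step _) (Trace.length_step ht h1) h2 hρ
    · obtain ⟨s1, h1, h2⟩ := Option.bind_eq_some_iff.1 h
      simp only [BWord.resolutions, List.mem_map] at hρ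
      obtain ⟨ρ, hρ, rfl⟩ := hρ
      exact ih (hv.step _) (Trace.length_step ht h1) h2 hρ
    · simp only [BWord.link, Word.run_append] at h
      obtain ⟨s1, h1, h2⟩ := Option.bind_eq_some_iff.1 h
      obtain ⟨rfl, pre, r, rfl, rfl⟩ := lockWord_run h1
      simp only [BWord.resolutions, List.mem_append, List.mem_map] at hρ
      obtain ⟨e1, e2⟩ := Trace.count_unhooked_smoothed hv ht rfl d o c (BWord.link B)
      simp only [BWord.link]
      rcases hρ with ⟨ρ, hρ, rfl⟩ | ⟨ρ, hρ, rfl⟩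
      · have := ih (hv.foldl _) (Trace.length_foldl ht (unhooked_run d o pre r)) h2 hρ
        rw [← Trace.count_append, ← Trace.count_append] at this
        dsimp only
        omega
      · have := ih (hv.foldl _) (Trace.length_foldl ht (smoothed_run d o pre r)) h2 hρ
        rw [← Trace.count_append, ← Trace.count_append] at this
        cases c <;> dsimp only <;> omega

/-- The witness is the resolution in which every lock is unhooked. It fixes the parity in
`BWord.components_resolution`. -/
lemma BWord.exists_resolution_count_eq {B : BWord} {s s' : List Bool} {t : Trace} (hv : t.Valid)
    (ht : t.labels.length = s.length) (h : B.link.run s = some s') :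
    ∃ ρ ∈ B.resolutions, ρ.b = 0 ∧ ρ.c = 0 ∧ t.count ρ.cycles = t.count B.link := by
  induction B generalizing s t with
  | nil => exact ⟨⟨[], 0, 0⟩, by simp [BWord.resolutions], rfl, rfl, rfl⟩
  | cons x B ih =>
    obtain ⟨k, o | o | ⟨d, o, c⟩⟩ := x
    · obtain ⟨s1, h1, h2⟩ := Option.bind_eq_some_iff.1 h
      obtain ⟨ρ, hρ, hb, hc, e⟩ := ih (hv.step _) (Trace.length_step ht h1) h2
      exact ⟨_, List.mem_map_of_mem hρ, hb, hc, e⟩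
    · obtain ⟨s1, h1, h2⟩ := Option.bind_eq_some_iff.1 h
      obtain ⟨ρ, hρ, hb, hc, e⟩ := ih (hv.step _) (Trace.length_step ht h1) h2
      exact ⟨_, List.mem_map_of_mem hρ, hb, hc, e⟩
    · simp only [BWord.link, Word.run_append] at h
      obtain ⟨s1, h1, h2⟩ := Option.bind_eq_some_iff.1 h
      obtain ⟨rfl, pre, r, rfl, rfl⟩ := lockWord_run h1
      obtain ⟨e1, -⟩ := Trace.count_unhooked_smoothed hv ht rfl d o c (BWord.link B)
      obtain ⟨ρ, hρ, hb, hc, e⟩ :=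
        ih (hv.foldl _) (Trace.length_foldl ht (unhooked_run d o pre r)) h2
      refine ⟨_, List.mem_append_left _ (List.mem_map_of_mem hρ), hb, hc, ?_⟩
      dsimp only [BWord.link]
      rw [e1, Trace.count_append, e, Trace.count_append]

/-! ### The rotation number modulo 2 -/

/-- The contribution of a piece to the rotation number modulo 2. -/
def Piece.rot : Piece → ℕ
  | .cup false => 1
  | .cap true => 1
  | _ => 0

/-- The rotation number of a diagram without crossings modulo 2. -/
def Word.rot (w : Word) : ℕ := (w.map fun x => x.2.rot).sum

@[simp] lemma Word.rot_nil : Word.rot [] = 0 := rfl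

@[simp] lemma Word.rot_cons (k : ℕ) (p : Piece) (w : Word) :
    Word.rot ((k, p) :: w) = p.rot + Word.rot w := by simp [Word.rot]

@[simp] lemma Word.rot_append (w w' : Word) : Word.rot (w ++ w') = w.rot + w'.rot := by
  simp [Word.rot]

/-- Unhooking preserves the rotation number modulo 2. The two resolutions of a lock differ by a
maximum and a minimum with the same `o`, exactly one of which is counted. -/
lemma BWord.rot_resolution {B : BWord} {ρ : Resolution} (hρ : ρ ∈ B.resolutions) :
    (ρ.cycles.rot + ρ.b + ρ.c) % 2 = B.link.rot % 2 := by
  induction B generalizing ρ with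
  | nil =>
    simp only [BWord.resolutions, List.mem_singleton] at hρ
    subst hρ
    simp [BWord.link]
  | cons x B ih =>
    obtain ⟨k, o | o | ⟨d, o, c⟩⟩ := x <;>
      simp only [BWord.resolutions, List.mem_append, List.mem_map] at hρ
    · obtain ⟨ρ, hρ, rfl⟩ := hρ
      have := ih hρ
      simp only [BWord.link, Word.rot_cons]
      omega
    · obtain ⟨ρ, hρ, rfl⟩ := hρ
      have := ih hρ
      simp only [BWord.link, Word.rot_cons]
      omega
    · have h1 : (lockWord k d o c).rot % 2 = (unhooked k d o).rot % 2 := by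
        cases d <;> cases o <;>
          simp [lockWord, unhooked, crossUpDown, crossDownUp, crossDown, Piece.rot]
      have h2 : (smoothed k d o).rot % 2 = ((unhooked k d o).rot + 1) % 2 := by
        cases d <;> cases o <;> simp [smoothed, unhooked, Piece.rot]
      rcases hρ with ⟨ρ, hρ, rfl⟩ | ⟨ρ, hρ, rfl⟩
      · have := ih hρ
        simp only [BWord.link, Word.rot_append]
        omega
      · have := ih hρ
        cases c <;> simp only [BWord.link, Word.rot_append] <;> omega

/-! ### Diagrams without crossings -/

/-- The quantum dimension of the fundamental representation. -/
def quantumDim (N : ℕ) : ℤ[T;T⁻¹] := ∑ c : Fin N, capWeight N true c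

/-- The two orientations of a circle give inverse weights; reversing the order of the colours
exchanges them. -/
lemma sum_cap_mul_cup (N : ℕ) (o : Bool) :
    ∑ c : Fin N, capWeight N o c * cupWeight N o c = quantumDim N := by
  cases o
  · simp only [capWeight_false, one_mul, quantumDim]
    rw [← Equiv.sum_comp Fin.revPerm]
    refine Finset.sum_congr rfl fun c _ => ?_
    simp only [cupWeight, capWeight, Fin.revPerm_apply, Fin.val_rev, if_true, Bool.false_eq_true,
      if_false]
    congr 1
    have := c.2
    omega
  · simp [quantumDim]

lemma cap_mul_cup_not {N : ℕ} (o : Bool) (c : Fin N) :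
    capWeight N o c * cupWeight N (!o) c = 1 := by
  cases o
  · simp
  · exact cap_mul_cup c

lemma Sim.trans {t t' t'' : Trace} (h : Sim 0 0 t t') (h' : Sim 0 0 t' t'') : Sim 0 0 t t'' := by
  obtain ⟨hv, hv', f, hf, hi⟩ := h
  obtain ⟨-, hv'', g, hg, hj⟩ := h'
  refine ⟨hv, hv'', g ∘ f, by rw [hg, hf, List.map_map], fun x hx y hy hxy => ?_⟩
  have := hj (f x) (hf ▸ List.mem_map_of_mem hx) (f y) (hf ▸ List.mem_map_of_mem hy) hxy
  have := hi x hx y hy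
  grind

lemma Sim.foldl {t t' : Trace} (h : Sim 0 0 t t') (w : Word) :
    Sim 0 0 (w.foldl Trace.step t) (w.foldl Trace.step t') := by
  induction w generalizing t t' with
  | nil => exact h
  | cons x w ih =>
    rcases h.step x with ⟨a', b', hab, hs, -⟩ | ⟨hne, -⟩
    · obtain rfl := hab rfl
      obtain ⟨hv, hv', f, hf, hi⟩ := hs
      exact ih ⟨hv, hv', f, hf, fun x hx y hy hxy => Or.inl (by
        rcases hi x hx y hy hxy with h | h | h
        · exact h
        · exact h.1.trans h.2.symm
        · exact h.1.trans h.2.symm)⟩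
    · exact absurd rfl hne

/-! ### Planar isotopies and removal of circles -/

/-- Above strands with directions `s`, the word `a` can be replaced by the word `b` and `n` disjoint
circles. -/
structure Move (a b : Word) (n : ℕ) (s : List Bool) : Prop where
  run : ∃ s', a.run s = some s' ∧ b.run s = some s'
  act : ∀ (N : ℕ) (v : List (Fin N) → ℤ[T;T⁻¹]), Supported s.length v →
    a.foldl (Piece.act N) v = fun l => quantumDim N ^ n * b.foldl (Piece.act N) v l
  sim : ∀ t : Trace, t.Valid → t.labels.length = s.length →
    Sim 0 0 (b.foldl Trace.step t) (a.foldl Trace.step t) ∧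
      (a.foldl Trace.step t).closed = (b.foldl Trace.step t).closed + n
  rot : a.rot % 2 = (b.rot + n) % 2

lemma Move.refl {a : Word} {s s' : List Bool} (h : a.run s = some s') : Move a a 0 s where
  run := ⟨s', h, h⟩
  act N v _ := by simp
  sim t ht _ := ⟨Sim.of_labels_eq (ht.foldl a) (ht.foldl a) rfl, rfl⟩
  rot := rfl

lemma Move.trans {a b c : Word} {m n : ℕ} {s : List Bool} (h : Move a b m s) (h' : Move b c n s) :
    Move a c (m + n) s where
  run := by
    obtain ⟨s1, e1, e2⟩ := h.run
    obtain ⟨s2, e3, e4⟩ := h'.run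
    exact ⟨s1, e1, e4.trans (e3.symm.trans e2)⟩
  act N v hv := by
    rw [h.act N v hv, h'.act N v hv]
    funext l
    ring
  sim t ht hl := by
    have h1 := h.sim t ht hl
    have h2 := h'.sim t ht hl
    exact ⟨h2.1.trans h1.1, by omega⟩
  rot := by
    have h1 := h.rot
    have h2 := h'.rot
    omega

lemma Move.append_left {a b c : Word} {n : ℕ} {s s' : List Bool} (h : Move a b n s')
    (hc : c.run s = some s') : Move (c ++ a) (c ++ b) n s where
  run := by
    obtain ⟨s1, e1, e2⟩ := h.run
    exact ⟨s1, by rw [Word.run_append, hc]; exact e1, by rw [Word.run_append, hc]; exact e2⟩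
  act N v hv := by
    simp only [List.foldl_append]
    exact h.act N _ (Word.act_supported hv hc)
  sim t ht hl := by
    simp only [List.foldl_append]
    exact h.sim _ (ht.foldl c) (Trace.length_foldl hl hc)
  rot := by
    have := h.rot
    simp only [Word.rot_append]
    omega

lemma Move.append_right {a b c : Word} {n : ℕ} {s s' : List Bool} (h : Move a b n s)
    (hc : (a ++ c).run s = some s') : Move (a ++ c) (b ++ c) n s where
  run := by
    obtain ⟨s1, e1, e2⟩ := h.run
    refine ⟨s', hc, ?_⟩
    rw [Word.run_append, e1] at hc
    rw [Word.run_append, e2]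
    exact hc
  act N v hv := by
    simp only [List.foldl_append]
    rw [h.act N v hv, Word.act_smul]
  sim t ht hl := by
    simp only [List.foldl_append]
    obtain ⟨h1, h2⟩ := h.sim t ht hl
    have := h1.count_eq c
    simp only [Trace.count] at this
    exact ⟨h1.foldl c, by omega⟩
  rot := by
    have := h.rot
    simp only [Word.rot_append]
    omega

/-- It suffices to check a local move at position zero, on colourings of the length forced by the
upper boundary. -/
lemma act_eq_of_shift {N : ℕ} {a b : Word} {pre r s' : List Bool} {z : ℤ[T;T⁻¹]}
    (ha : Word.run (Word.shift pre.length a) (pre ++ r) = some s')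
    (hb : Word.run (Word.shift pre.length b) (pre ++ r) = some s')
    (h : ∀ (v : List (Fin N) → ℤ[T;T⁻¹]) (l : List (Fin N)), pre.length + l.length = s'.length →
      a.foldl (Piece.act N) v l = z * b.foldl (Piece.act N) v l)
    {v : List (Fin N) → ℤ[T;T⁻¹]} (hv : Supported (pre ++ r).length v) :
    (Word.shift pre.length a).foldl (Piece.act N) v =
      fun l => z * (Word.shift pre.length b).foldl (Piece.act N) v l := by
  funext l
  by_cases hl : l.length = s'.length
  · have hle : pre.length ≤ l.length := by
      rw [hl]
      rw [Word.run_shift] at ha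
      obtain ⟨r', -, rfl⟩ := Option.map_eq_some_iff.1 ha
      simp
    obtain ⟨p, q, hp, rfl⟩ : ∃ p q, p.length = pre.length ∧ l = p ++ q :=
      ⟨l.take pre.length, l.drop pre.length, by simp [hle], (List.take_append_drop _ l).symm⟩
    rw [← hp, Word.act_shift, Word.act_shift]
    refine h _ _ ?_
    rw [← hp, ← hl, List.length_append]
  · rw [Word.act_supported hv ha l hl, Word.act_supported hv hb l hl, mul_zero]

lemma Trace.exists_append {t : Trace} {pre r : List Bool}
    (ht : t.labels.length = (pre ++ r).length) :
    ∃ p q, p.length = pre.length ∧ q.length = r.length ∧ t = ⟨p ++ q, t.fresh, t.closed⟩ := by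
  obtain ⟨L, n, c⟩ := t
  simp only [List.length_append] at ht
  exact ⟨L.take pre.length, L.drop pre.length, by simp; omega, by simp; omega, by simp⟩

lemma Move.circle (pre r : List Bool) (o : Bool) :
    Move [(pre.length, .cup o), (pre.length, .cap o)] [] 1 (pre ++ r) where
  run := ⟨pre ++ r, by simp [Word.run, Piece.step], rfl⟩
  act N v hv := by
    refine act_eq_of_shift (a := [(0, .cup o), (0, .cap o)]) (b := []) (s' := pre ++ r)
      (by simp [Word.run, Piece.step]) rfl (fun v l _ => ?_) hv
    simp only [List.foldl_cons, List.foldl_nil, Piece.act_cap, Piece.act_cup, List.take_zero,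
      List.drop_zero, List.nil_append, if_true, pow_one, ← sum_cap_mul_cup N o, Finset.sum_mul,
      mul_assoc]
  sim t ht hl := by
    have hv := ht.foldl [(pre.length, Piece.cup o), (pre.length, Piece.cap o)]
    obtain ⟨p, q, hp, hq, e⟩ := Trace.exists_append hl
    have e2 : [(pre.length, Piece.cup o), (pre.length, Piece.cap o)].foldl Trace.step t =
        ⟨p ++ q, t.fresh + 1, t.closed + 1⟩ := by
      rw [e]
      simp [Trace.step_cup_zero, Trace.step_cap_zero, hp]
    refine ⟨Sim.of_labels_eq ht hv ?_, ?_⟩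
    · rw [e2, List.foldl_nil, e]
    · rw [e2, List.foldl_nil]
  rot := by cases o <;> simp [Piece.rot]

/-- On tensors this is the snake identity, with inverse weights of maximum and minimum. In a trace a
maximum keeps the left label, so here the strand takes over the fresh one; in the mirror move
`Move.zigzag_left` it keeps its own. -/
lemma Move.zigzag_right (pre r : List Bool) (o : Bool) :
    Move [(pre.length, .cup (!o)), (pre.length + 1, .cap o)] [] 0 (pre ++ (!o) :: r) where
  run := ⟨pre ++ (!o) :: r, by simp [Word.run, Piece.step, List.take_length_add_append], rfl⟩
  act N v hv := by
    refine act_eq_of_shift (a := [(0, .cup (!o)), (1, .cap o)]) (b := [])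
      (s' := pre ++ (!o) :: r) (by simp [Word.run, Piece.step, List.take_length_add_append]) rfl
      (fun v l hl => ?_) hv
    obtain ⟨a, l, rfl⟩ : ∃ a l', l = a :: l' := by
      rcases l with _ | ⟨a, l⟩
      · simp at hl
      · exact ⟨a, l, rfl⟩
    simp only [List.foldl_cons, List.foldl_nil, Piece.act_cap, Piece.act_cup, List.take_zero,
      List.drop_zero, List.nil_append, List.take_succ_cons, List.drop_succ_cons, List.cons_append,
      mul_ite, mul_zero, Finset.sum_ite_eq, Finset.mem_univ, if_true, pow_zero, one_mul,
      ← mul_assoc, cap_mul_cup_not]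
  sim t ht hl := by
    have hv := ht.foldl [(pre.length, Piece.cup (!o)), (pre.length + 1, Piece.cap o)]
    obtain ⟨p, q, hp, hq, e⟩ := Trace.exists_append hl
    obtain ⟨x, q, rfl⟩ : ∃ x q', q = x :: q' := by
      rcases q with _ | ⟨x, q⟩
      · simp at hq
      · exact ⟨x, q, rfl⟩
    have hx : x < t.fresh := ht x (by rw [e]; simp)
    have e2 : [(pre.length, Piece.cup (!o)), (pre.length + 1, Piece.cap o)].foldl Trace.step t =
        ⟨t.labels.map fun z => if z = x then t.fresh else z, t.fresh + 1, t.closed⟩ := by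
      rw [e]
      simp [Trace.step_cup_zero, Trace.step_cap, hp, hx.ne']
    refine ⟨⟨ht, hv, fun z => if z = x then t.fresh else z, ?_, ?_⟩, ?_⟩
    · rw [e2, List.foldl_nil]
    · intro z hz w hw hzw
      have := ht z hz
      have := ht w hw
      grind
    · rw [e2, List.foldl_nil]
      rfl
  rot := by cases o <;> simp [Piece.rot]

lemma Move.zigzag_left (pre r : List Bool) (o : Bool) :
    Move [(pre.length + 1, .cup (!o)), (pre.length, .cap o)] [] 0 (pre ++ o :: r) where
  run := ⟨pre ++ o :: r, by simp [Word.run, Piece.step, List.take_length_add_append], rfl⟩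
  act N v hv := by
    refine act_eq_of_shift (a := [(1, .cup (!o)), (0, .cap o)]) (b := [])
      (s' := pre ++ o :: r) (by simp [Word.run, Piece.step, List.take_length_add_append]) rfl
      (fun v l hl => ?_) hv
    obtain ⟨a, l, rfl⟩ : ∃ a l', l = a :: l' := by
      rcases l with _ | ⟨a, l⟩
      · simp at hl
      · exact ⟨a, l, rfl⟩
    simp only [List.foldl_cons, List.foldl_nil, Piece.act_cap, Piece.act_cup, List.take_zero,
      List.drop_zero, List.nil_append, List.take_succ_cons, List.drop_succ_cons, List.cons_append,
      mul_ite, mul_zero, Finset.sum_ite_eq', Finset.mem_univ, if_true, pow_zero, one_mul,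
      ← mul_assoc, cap_mul_cup_not]
  sim t ht hl := by
    have hv := ht.foldl [(pre.length + 1, Piece.cup (!o)), (pre.length, Piece.cap o)]
    obtain ⟨p, q, hp, hq, e⟩ := Trace.exists_append hl
    obtain ⟨x, q, rfl⟩ : ∃ x q', q = x :: q' := by
      rcases q with _ | ⟨x, q⟩
      · simp at hq
      · exact ⟨x, q, rfl⟩
    have hx : x < t.fresh := ht x (by rw [e]; simp)
    have hm : ∀ l : List ℕ, (∀ z ∈ l, z < t.fresh) →
        l.map (fun z => if z = t.fresh then x else z) = l := by
      intro l hl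
      conv_rhs => rw [← List.map_id l]
      exact map_congr_of_lt hl fun z hz => by grind
    have e2 : [(pre.length + 1, Piece.cup (!o)), (pre.length, Piece.cap o)].foldl Trace.step t =
        ⟨t.labels, t.fresh + 1, t.closed⟩ := by
      have hp' : ∀ z ∈ p, z < t.fresh := fun z hz => ht z (by rw [e]; simp [hz])
      have hq' : ∀ z ∈ q, z < t.fresh := fun z hz => ht z (by rw [e]; simp [hz])
      rw [e]
      simp [Trace.step_cup, Trace.step_cap_zero, hp, hx.ne, hm p hp', hm q hq']
    refine ⟨Sim.of_labels_eq ht hv ?_, ?_⟩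
    · rw [e2, List.foldl_nil]
    · rw [e2, List.foldl_nil]
      rfl
  rot := by cases o <;> simp [Piece.rot]

lemma Move.cup_cap_right (pre mid r : List Bool) (o o' : Bool) :
    Move [(pre.length, .cup o'), (pre.length + (mid.length + 2), .cap o)]
      [(pre.length + mid.length, .cap o), (pre.length, .cup o')] 0
      (pre ++ (mid ++ o :: (!o) :: r)) where
  run := ⟨pre ++ o' :: (!o') :: (mid ++ r),
    by simp [Word.run, Piece.step, List.take_length_add_append],
    by simp [Word.run, Piece.step, List.take_length_add_append]⟩
  act N v hv := by
    refine act_eq_of_shift (a := [(0, .cup o'), (mid.length + 2, .cap o)])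
      (b := [(mid.length, .cap o), (0, .cup o')]) (s' := pre ++ o' :: (!o') :: (mid ++ r))
      (by simp [Word.run, Piece.step, List.take_length_add_append])
      (by simp [Word.run, Piece.step, List.take_length_add_append])
      (fun v l hl => ?_) hv
    obtain ⟨a, b, l, rfl⟩ : ∃ a b l', l = a :: b :: l' := by
      rcases l with _ | ⟨a, _ | ⟨b, l⟩⟩
      · simp at hl
      · simp at hl
      · exact ⟨a, b, l, rfl⟩
    simp only [List.foldl_cons, List.foldl_nil, Piece.act_cap, Piece.act_cup, List.take_zero,
      List.drop_zero, List.nil_append, List.take_succ_cons, List.drop_succ_cons, List.cons_append,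
      pow_zero, one_mul]
    split_ifs
    · rw [Finset.mul_sum]
      exact Finset.sum_congr rfl fun c _ => by ring
    · simp
  sim t ht hl := by
    have hv := ht.foldl [(pre.length, Piece.cup o'), (pre.length + (mid.length + 2), Piece.cap o)]
    have hv' := ht.foldl [(pre.length + mid.length, Piece.cap o), (pre.length, Piece.cup o')]
    obtain ⟨p, q, hp, hq, e⟩ := Trace.exists_append hl
    obtain ⟨M, x, y, R, hM, rfl⟩ : ∃ M x y R, M.length = mid.length ∧ q = M ++ x :: y :: R := by
      obtain ⟨M, x, y, R, hM, hq'⟩ := Trace.exists_split (t := ⟨q, 0, 0⟩) hq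
      exact ⟨M, x, y, R, hM, congrArg Trace.labels hq'⟩
    have hy : y < t.fresh := ht y (by rw [e]; simp)
    have e2 : [(pre.length, Piece.cup o'), (pre.length + (mid.length + 2), Piece.cap o)].foldl
        Trace.step t =
        [(pre.length + mid.length, Piece.cap o), (pre.length, Piece.cup o')].foldl
          Trace.step t := by
      rw [e, ← hM]
      by_cases hxy : x = y <;>
        simp [Trace.step_cup_zero, Trace.step_cap, hp, hy.ne', hxy]
    refine ⟨Sim.of_labels_eq hv' hv ?_, ?_⟩ <;> rw [e2]
    rfl
  rot := by
    simp only [Word.rot_cons, Word.rot_nil]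
    omega

lemma Move.cup_cap_left (pre mid r : List Bool) (o o' : Bool) :
    Move [(pre.length + (mid.length + 2), .cup o'), (pre.length, .cap o)]
      [(pre.length, .cap o), (pre.length + mid.length, .cup o')] 0
      (pre ++ o :: (!o) :: (mid ++ r)) where
  run := ⟨pre ++ (mid ++ o' :: (!o') :: r),
    by simp [Word.run, Piece.step, List.take_length_add_append],
    by simp [Word.run, Piece.step, List.take_length_add_append]⟩
  act N v hv := by
    refine act_eq_of_shift (a := [(mid.length + 2, .cup o'), (0, .cap o)])
      (b := [(0, .cap o), (mid.length, .cup o')]) (s' := pre ++ (mid ++ o' :: (!o') :: r))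
      (by simp [Word.run, Piece.step, List.take_length_add_append])
      (by simp [Word.run, Piece.step, List.take_length_add_append])
      (fun v l hl => ?_) hv
    simp only [List.foldl_cons, List.foldl_nil, Piece.act_cap, Piece.act_cup, List.take_zero,
      List.drop_zero, List.nil_append, List.take_succ_cons, List.drop_succ_cons, List.cons_append,
      pow_zero, one_mul]
    rcases l.drop mid.length with _ | ⟨a, _ | ⟨b, l'⟩⟩
    · simp
    · simp
    · dsimp only
      split_ifs
      · rw [Finset.mul_sum]
        exact Finset.sum_congr rfl fun c _ => by ring
      · simp
  sim t ht hl := by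
    have hv := ht.foldl [(pre.length + (mid.length + 2), Piece.cup o'), (pre.length, Piece.cap o)]
    have hv' := ht.foldl [(pre.length, Piece.cap o), (pre.length + mid.length, Piece.cup o')]
    obtain ⟨p, q, hp, hq, e⟩ := Trace.exists_append hl
    obtain ⟨x, y, q, rfl⟩ : ∃ x y q', q = x :: y :: q' := by
      rcases q with _ | ⟨x, _ | ⟨y, q⟩⟩
      · simp at hq
      · simp at hq
      · exact ⟨x, y, q, rfl⟩
    have hy : y < t.fresh := ht y (by rw [e]; simp)
    have e2 : [(pre.length + (mid.length + 2), Piece.cup o'), (pre.length, Piece.cap o)].foldl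
        Trace.step t =
        [(pre.length, Piece.cap o), (pre.length + mid.length, Piece.cup o')].foldl
          Trace.step t := by
      rw [e]
      by_cases hxy : x = y <;>
        simp [Trace.step_cup, Trace.step_cap_zero, hp, hy.ne', hxy, List.map_take, List.map_drop]
    refine ⟨Sim.of_labels_eq hv' hv ?_, ?_⟩ <;> rw [e2]
    rfl
  rot := by
    simp only [Word.rot_cons, Word.rot_nil]
    omega

/-- The diagram consisting of the given minima. -/
def cupWord (u : List (ℕ × Bool)) : Word := u.map fun x => (x.1, .cup x.2)

lemma cupWord_append (u u' : List (ℕ × Bool)) : cupWord (u ++ u') = cupWord u ++ cupWord u' :=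
  List.map_append

lemma cupWord_singleton (k : ℕ) (o : Bool) : cupWord [(k, o)] = [(k, .cup o)] := rfl

lemma Word.run_singleton (k : ℕ) (p : Piece) (s : List Bool) :
    Word.run [(k, p)] s = p.step k s := by
  simp only [Word.run]
  cases p.step k s <;> rfl

/-- The maximum is compared with the topmost minimum: at equal positions they form a circle, at
adjacent positions a zigzag that straightens, and otherwise they commute and the maximum moves
further down. The last clause records that a circle was split off or minima remain, so that a
nonempty diagram yields at least one circle. -/
lemma Move.exists_cupWord (u : List (ℕ × Bool)) {s s' : List Bool} {k : ℕ} {o : Bool}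
    (hu : (cupWord u).run [] = some s) (hs : Piece.step k (.cap o) s = some s') :
    ∃ u' n, Move (cupWord u ++ [(k, .cap o)]) (cupWord u') n [] ∧ (n = 1 ∨ u' ≠ []) := by
  induction u using List.reverseRecOn generalizing s s' k with
  | nil =>
    obtain rfl := Option.some.inj hu
    obtain ⟨pre, r, -, h, -⟩ := (Piece.step_cap_iff _ _ _ _).1 hs
    simp at h
  | append_singleton u x ih =>
    obtain ⟨k', o'⟩ := x
    rw [cupWord_append, Word.run_append] at hu
    obtain ⟨s0, h0, h1⟩ := Option.bind_eq_some_iff.1 hu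
    rw [cupWord_singleton, Word.run_singleton] at h1
    obtain ⟨p, q, rfl, rfl, rfl⟩ := (Piece.step_cup_iff _ _ _ _).1 h1
    obtain ⟨p1, q1, rfl, hpq, rfl⟩ := (Piece.step_cap_iff _ _ _ _).1 hs
    have hlen := congrArg List.length hpq
    simp only [List.length_append, List.length_cons] at hlen
    -- In the zigzag cases a strand passes below the topmost minimum, so some other minimum must
    -- have created it.
    have hne : p ++ q ≠ [] → u ≠ [] := by
      rintro h rfl
      exact h (Option.some.inj h0).symm
    rw [cupWord_append, cupWord_singleton, List.append_assoc]
    rcases Nat.lt_trichotomy p.length p1.length with h | h | h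
    · rcases Nat.lt_or_ge (p.length + 1) p1.length with h' | h'
      · obtain ⟨mid, hm⟩ : ∃ mid, p1 = p ++ (o' :: (!o') :: mid) := by
          have e := congrArg (List.take p1.length) hpq
          rw [List.take_left, List.take_append, List.take_of_length_le h.le] at e
          obtain ⟨j, hj⟩ := Nat.exists_eq_add_of_lt h'
          refine ⟨q.take j, ?_⟩
          rw [← e, show p1.length - p.length = j + 2 by omega]
          rfl
        subst hm
        simp only [List.append_assoc, List.cons_append, List.append_cancel_left_eq,
          List.cons.injEq, true_and] at hpq
        subst hpq
        have hmove := Move.cup_cap_right p mid q1 o o'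
        have hfit : Piece.step (p.length + mid.length) (.cap o) (p ++ (mid ++ o :: (!o) :: q1)) =
            some (p ++ (mid ++ q1)) :=
          (Piece.step_cap_iff _ _ _ _).2 ⟨p ++ mid, q1, by simp, by simp, by simp⟩
        obtain ⟨u', n, hmv, -⟩ := ih h0 hfit
        refine ⟨u' ++ [(p.length, o')], n, ?_, Or.inr (by simp)⟩
        have h2 := hmove.append_left h0
        have h3 := hmv.append_right (c := [(p.length, .cup o')])
          (s' := p ++ o' :: (!o') :: (mid ++ q1)) (by
            simp only [Word.run_append, h0, Option.bind_some, Word.run_singleton, hfit]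
            simp [Piece.step])
        rw [cupWord_append, cupWord_singleton]
        have h4 := h2.trans (by simpa using h3)
        simpa [add_assoc] using h4
      · have hp1 : p1.length = p.length + 1 := by omega
        obtain ⟨y, rfl⟩ : ∃ y, p1 = p ++ [y] := by
          have e := congrArg (List.take p1.length) hpq
          rw [List.take_left, List.take_append, List.take_of_length_le h.le, hp1] at e
          exact ⟨o', by rw [← e]; simp⟩
        simp only [List.append_assoc, List.cons_append, List.nil_append,
          List.append_cancel_left_eq, List.cons.injEq] at hpq
        obtain ⟨rfl, rfl, rfl⟩ := hpq
        refine ⟨u, 0, ?_, Or.inr (hne (by simp))⟩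
        have := (Move.zigzag_right p q1 (!o')).append_left (by simpa using h0)
        simpa using this
    · obtain ⟨rfl, h2⟩ := List.append_inj hpq h
      simp only [List.cons.injEq] at h2
      obtain ⟨rfl, -, rfl⟩ := h2
      exact ⟨u, 1, by simpa using (Move.circle p q o').append_left h0, Or.inl rfl⟩
    · rcases Nat.lt_or_ge (p1.length + 1) p.length with h' | h'
      · obtain ⟨mid, hm⟩ : ∃ mid, p = p1 ++ (o :: (!o) :: mid) := by
          have e := congrArg (List.take p.length) hpq
          rw [List.take_left, List.take_append, List.take_of_length_le h.le] at e
          obtain ⟨j, hj⟩ := Nat.exists_eq_add_of_lt h'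
          refine ⟨q1.take j, ?_⟩
          rw [e, show p.length - p1.length = j + 2 by omega]
          rfl
        subst hm
        simp only [List.append_assoc, List.cons_append, List.append_cancel_left_eq,
          List.cons.injEq, true_and] at hpq
        subst hpq
        simp only [List.append_assoc, List.cons_append] at h0
        have hmove := Move.cup_cap_left p1 mid q o o'
        have hfit : Piece.step p1.length (.cap o) (p1 ++ o :: (!o) :: (mid ++ q)) =
            some (p1 ++ (mid ++ q)) :=
          (Piece.step_cap_iff _ _ _ _).2 ⟨p1, _, rfl, rfl, rfl⟩
        obtain ⟨u', n, hmv, -⟩ := ih h0 hfit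
        refine ⟨u' ++ [(p1.length + mid.length, o')], n, ?_, Or.inr (by simp)⟩
        have h2 := hmove.append_left h0
        have h3 := hmv.append_right (c := [(p1.length + mid.length, .cup o')])
          (s' := p1 ++ (mid ++ o' :: (!o') :: q)) (by
            simp only [Word.run_append, h0, Option.bind_some, Word.run_singleton, hfit]
            simp [Piece.step, List.take_length_add_append])
        rw [cupWord_append, cupWord_singleton]
        have h4 := h2.trans (by simpa using h3)
        simpa [add_assoc] using h4
      · have hp1 : p.length = p1.length + 1 := by omega
        obtain ⟨y, rfl⟩ : ∃ y, p = p1 ++ [y] := by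
          have e := congrArg (List.take p.length) hpq
          rw [List.take_left, List.take_append, List.take_of_length_le h.le, hp1] at e
          exact ⟨o, by rw [e]; simp⟩
        simp only [List.append_assoc, List.cons_append, List.nil_append,
          List.append_cancel_left_eq, List.cons.injEq] at hpq
        obtain ⟨rfl, rfl, rfl⟩ := hpq
        refine ⟨u, 0, ?_, Or.inr (hne (by simp))⟩
        have := (Move.zigzag_left p1 q y).append_left (by simpa using h0)
        simpa using this

lemma Move.exists_circles (w : Word) (hw : w.Planar) (u : List (ℕ × Bool))
    (h : (cupWord u ++ w).run [] = some []) :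
    ∃ n, Move (cupWord u ++ w) [] n [] ∧ (cupWord u ++ w ≠ [] → 1 ≤ n) := by
  induction w generalizing u with
  | nil =>
    rw [List.append_nil] at h ⊢
    -- A topmost minimum would leave two loose ends.
    have hu : u = [] := by
      induction u using List.reverseRecOn with
      | nil => rfl
      | append_singleton u x _ =>
        rw [cupWord_append, Word.run_append] at h
        obtain ⟨s0, -, h1⟩ := Option.bind_eq_some_iff.1 h
        rw [cupWord_singleton, Word.run_singleton] at h1
        obtain ⟨p, q, -, -, h2⟩ := (Piece.step_cup_iff _ _ _ _).1 h1
        simp at h2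
    subst hu
    exact ⟨0, Move.refl rfl, fun h => absurd rfl h⟩
  | cons x w ih =>
    have hw' : Word.Planar w := fun k c hk => hw k c (List.mem_cons_of_mem _ hk)
    obtain ⟨k, o | o | c⟩ := x
    · have e : cupWord u ++ (k, .cup o) :: w = cupWord (u ++ [(k, o)]) ++ w := by
        simp [cupWord_append, cupWord_singleton]
      rw [e] at h ⊢
      exact ih hw' _ h
    · have e : cupWord u ++ (k, .cap o) :: w = cupWord u ++ [(k, .cap o)] ++ w := by simp
      rw [e] at h ⊢
      have h' := h
      rw [Word.run_append, Word.run_append] at h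
      obtain ⟨s1, h1, -⟩ := Option.bind_eq_some_iff.1 h
      obtain ⟨s0, h0, h2⟩ := Option.bind_eq_some_iff.1 h1
      rw [Word.run_singleton] at h2
      obtain ⟨u', n, hm, hn⟩ := Move.exists_cupWord u h0 h2
      have hm' := hm.append_right h'
      have hrun : (cupWord u' ++ w).run [] = some [] := by
        obtain ⟨s2, e1, e2⟩ := hm'.run
        rw [e2, ← e1, h']
      obtain ⟨n', hm2, hn2⟩ := ih hw' u' hrun
      refine ⟨n + n', hm'.trans hm2, fun _ => ?_⟩
      rcases hn with rfl | hn
      · omega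
      · have := hn2 (by simp [cupWord, hn])
        omega
    · exact absurd (List.mem_cons_self) (hw k c)

/-- One reduction to `n` circles supplies all three statements, since a `Move` tracks the tensor
value, the component count and the rotation number simultaneously. -/
lemma Word.planar_eval {w : Word} (hw : w.Planar) (h : w.run [] = some []) :
    (∀ N, w.rt N = quantumDim N ^ w.components) ∧ w.components % 2 = w.rot % 2 ∧
      (w ≠ [] → 1 ≤ w.components) := by
  obtain ⟨n, hm, hn⟩ := Move.exists_circles w hw [] h
  simp only [cupWord, List.map_nil, List.nil_append] at hm hn
  have hc : w.components = n := by
    have := (hm.sim ⟨[], 0, 0⟩ (by simp [Trace.Valid]) rfl).2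
    simpa [Word.components] using this
  refine ⟨fun N => ?_, ?_, ?_⟩
  · have := hm.act N (fun l => if l = [] then 1 else 0)
      (fun l hl => if_neg fun h => hl (by simp [h]))
    rw [Word.rt, this, hc]
    simp
  · have := hm.rot
    rw [hc, this]
    simp
  · rwa [hc]

/-! ### The planar sum -/

lemma lockWord_writhe (k : ℕ) (d : Locking) (o : Bool) (c : Colour) (w : Word) :
    Word.writhe (lockWord k d o c ++ w) =
      (match c with | .black => 2 | .white => -2) + Word.writhe w := by
  cases d <;> cases o <;> cases c <;>
    simp [lockWord, crossDown, crossUpDown, crossDownUp, Word.writhe] <;> ring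

lemma BWord.writhe_link (B : BWord) :
    B.link.writhe = 2 * ((B.count .black : ℤ) - B.count .white) := by
  induction B with
  | nil => simp [BWord.link, Word.writhe, BWord.count]
  | cons x B ih =>
    obtain ⟨k, o | o | ⟨d, o, c⟩⟩ := x
    · simpa [BWord.link, Word.writhe, BWord.count] using ih
    · simpa [BWord.link, Word.writhe, BWord.count] using ih
    · simp only [BWord.link, lockWord_writhe, ih]
      cases c <;> simp [BWord.count] <;> ring

lemma phi_q₁ (N : ℕ) : phi (q₁ ^ N) q₁ = Colour.black.skein * Colour.black.kink N := by
  simp only [phi, Colour.skein, Colour.kink, Units.val_pow_eq_pow_val]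
  rw [show ((q₁ : ℤ[T;T⁻¹])) = T 1 from rfl, T_pow, mul_one, mul_comm]

lemma phiBar_q₁ (N : ℕ) : phiBar (q₁ ^ N) q₁ = Colour.white.skein * Colour.white.kink N := by
  simp only [phiBar, Colour.skein, Colour.kink, ← inv_pow, Units.val_pow_eq_pow_val]
  rw [show ((q₁⁻¹ : (ℤ[T;T⁻¹])ˣ) : ℤ[T;T⁻¹]) = T (-1) from rfl, T_pow]
  simp only [mul_neg, mul_one]
  ring

lemma BWord.slN_link {B : BWord} (hB : B.link.IsLinkDiagram) (N : ℕ) :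
    B.link.slN N = B.framing (q₁ ^ N) *
      B.planarSum (quantumDim N) (phi (q₁ ^ N) q₁) (phiBar (q₁ ^ N) q₁) := by
  have hδ : Supported (N := N) ([] : List Bool).length (fun l => if l = [] then 1 else 0) :=
    fun l hl => if_neg fun h => hl (by simp [h])
  have hrt : B.link.rt N =
      B.planarSum (quantumDim N) (phi (q₁ ^ N) q₁) (phiBar (q₁ ^ N) q₁) := by
    rw [Word.rt, BWord.act_link hδ hB, BWord.planarSum, phi_q₁, phiBar_q₁]
    refine congrArg List.sum (List.map_congr_left fun ρ hρ => ?_)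
    have := (Word.planar_eval (BWord.resolutions_planar hρ) (BWord.resolutions_run hB hρ)).1 N
    rw [Word.rt] at this
    rw [this, mul_comm, mul_assoc]
  rw [Word.slN, BWord.framing, hrt, BWord.writhe_link, neg_mul]

lemma quantumDim_mul (N : ℕ) : quantumDim N * bracket q₁ = bracket (q₁ ^ N) := by
  have h := Finset.sum_range_sub (fun i : ℕ => (T (2 * (i : ℤ) - N) : ℤ[T;T⁻¹])) N
  rw [← Fin.sum_univ_eq_sum_range (fun i : ℕ =>
    (T (2 * ((i + 1 : ℕ) : ℤ) - N) : ℤ[T;T⁻¹]) - T (2 * (i : ℤ) - N))] at h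
  rw [quantumDim, Finset.sum_mul]
  have e : bracket (q₁ ^ N) = (T N - T (-N) : ℤ[T;T⁻¹]) := by
    rw [bracket, ← inv_pow, Units.val_pow_eq_pow_val, Units.val_pow_eq_pow_val,
      show (q₁ : ℤ[T;T⁻¹]) = T 1 from rfl,
      show ((q₁⁻¹ : (ℤ[T;T⁻¹])ˣ) : ℤ[T;T⁻¹]) = T (-1) from rfl, T_pow, T_pow]
    simp
  rw [e]
  refine Eq.trans (Finset.sum_congr rfl fun c _ => ?_) (h.trans ?_)
  · simp only [capWeight, if_true, bracket_q₁, mul_sub, ← T_add]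
    congr 2 <;> push_cast <;> ring
  · congr 2 <;> push_cast <;> ring

lemma quantumDim_one : quantumDim 1 = 1 := by
  simp [quantumDim, capWeight]

/-! ### Planar sums over arbitrary commutative rings -/

section CommRing

variable {R S : Type*} [CommRing R] [CommRing S]

lemma map_bracket (f : R →+* S) (x : Rˣ) :
    f (bracket x) = bracket (Units.map f.toMonoidHom x) := by
  simp only [bracket, map_sub]
  rfl

lemma map_phi (f : R →+* S) (x y : Rˣ) :
    f (phi x y) = phi (Units.map f.toMonoidHom x) (Units.map f.toMonoidHom y) := by
  simp only [phi, map_mul, map_bracket]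
  rfl

lemma map_phiBar (f : R →+* S) (x y : Rˣ) :
    f (phiBar x y) = phiBar (Units.map f.toMonoidHom x) (Units.map f.toMonoidHom y) := by
  simp only [phiBar, map_mul, map_neg, map_bracket]
  rfl

lemma map_framing (f : R →+* S) (B : BWord) (x : Rˣ) :
    f (B.framing x) = B.framing (Units.map f.toMonoidHom x) := by
  simp only [BWord.framing, ← map_zpow]
  rfl

lemma bracket_mul_bracket (x y : Rˣ) :
    bracket (x * y) * bracket (x / y) = bracket x ^ 2 - bracket y ^ 2 := by
  have hx := x.mul_inv
  have hy := y.mul_inv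
  simp only [bracket, div_eq_mul_inv, mul_inv_rev, inv_inv, Units.val_mul]
  linear_combination ((x : R) ^ 2 + ((x⁻¹ : Rˣ) : R) ^ 2) * hy -
    ((y : R) ^ 2 + ((y⁻¹ : Rˣ) : R) ^ 2) * hx + 2 * hx - 2 * hy

lemma one_add_phi_self (x : Rˣ) : 1 + phi x x = ((x ^ 2 : Rˣ) : R) := by
  have hx := x.mul_inv
  simp only [phi, bracket, Units.val_pow_eq_pow_val]
  linear_combination -hx

lemma one_add_phiBar_self (x : Rˣ) : 1 + phiBar x x = ((x ^ (-2 : ℤ) : Rˣ) : R) := by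
  have hx := x.mul_inv
  rw [zpow_neg, ← inv_zpow]
  simp only [phiBar, bracket, zpow_ofNat, Units.val_pow_eq_pow_val]
  linear_combination -hx

/-- Each black lock contributes `x ^ 2` and each white lock `x ^ (-2)`. The generality in `x`
matters: the identity is used at `q₁` for the specialisation and at `A₂` for the divisibility. -/
lemma BWord.framing_mul (B : BWord) (x : Rˣ) :
    B.framing x * ((1 + phi x x) ^ B.count .black * (1 + phiBar x x) ^ B.count .white) = 1 := by
  rw [one_add_phi_self, one_add_phiBar_self, BWord.framing, ← Units.val_pow_eq_pow_val,
    ← Units.val_pow_eq_pow_val, ← Units.val_mul, ← Units.val_mul, ← Units.val_one]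
  congr 1
  rw [← zpow_natCast, ← zpow_natCast, ← zpow_natCast, ← zpow_mul, ← zpow_mul, ← zpow_add,
    ← zpow_add, ← zpow_zero x]
  congr 1
  push_cast
  ring

lemma BWord.planarSum_one (B : BWord) (φ φ' : R) :
    B.planarSum 1 φ φ' = (1 + φ) ^ B.count .black * (1 + φ') ^ B.count .white := by
  induction B with
  | nil => simp [BWord.planarSum, BWord.resolutions, BWord.count]
  | cons x B ih =>
    simp only [BWord.planarSum, one_pow, one_mul] at ih ⊢
    obtain ⟨k, o | o | ⟨d, o, c⟩⟩ := x
    · simpa [BWord.resolutions, BWord.count, Function.comp_def] using ih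
    · simpa [BWord.resolutions, BWord.count, Function.comp_def] using ih
    · have e : ∀ c' : Colour, BWord.count ((k, .lock d o c) :: B) c' =
          (if c = c' then 1 else 0) + BWord.count B c' := by
        intro c'
        simp [BWord.count]
      rw [e, e]
      simp only [BWord.resolutions, List.map_append, List.sum_append, List.map_map,
        Function.comp_def, ih]
      cases c
      · simp only [pow_succ, mul_right_comm _ φ, List.sum_map_mul_right, ih, if_true,
          reduceCtorEq, if_false]
        ring
      · simp only [pow_succ, ← mul_assoc, List.sum_map_mul_right, ih, if_true,
          reduceCtorEq, if_false]
        ring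

/-- The planar sum with the denominators cleared. -/
lemma BWord.planarSum_cleared (B : BWord) (D φ φ' : R) (x y : R) (hD : D * y = x) {m : ℕ}
    (hm : ∀ ρ ∈ B.resolutions, ρ.cycles.components ≤ m) :
    y ^ m * B.planarSum D φ φ' = (B.resolutions.map fun ρ =>
      x ^ ρ.cycles.components * y ^ (m - ρ.cycles.components) * φ ^ ρ.b * φ' ^ ρ.c).sum := by
  rw [BWord.planarSum, ← List.sum_map_mul_left]
  congr 1
  refine List.map_congr_left fun ρ hρ => ?_
  obtain ⟨j, hj⟩ := Nat.exists_eq_add_of_le (hm ρ hρ)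
  rw [hj, Nat.add_sub_cancel_left, ← hD]
  ring

lemma dvd_list_sum_sub {α : Type*} {d : R} {l : List α} {f g : α → R}
    (h : ∀ a ∈ l, d ∣ f a - g a) : d ∣ (l.map f).sum - (l.map g).sum := by
  induction l with
  | nil => simp
  | cons a l ih =>
    simp only [List.map_cons, List.sum_cons, add_sub_add_comm]
    exact dvd_add (h a List.mem_cons_self) (ih fun b hb => h b (List.mem_cons_of_mem _ hb))

end CommRing

/-! ### Substitutions -/

lemma map_substA_A₂ (N : ℕ) : Units.map (substA N).toMonoidHom A₂ = q₁ ^ N := by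
  ext1
  show substA N (T 1) = _
  rw [substA, eval₂_T]
  simp

lemma map_substA_q₂ (N : ℕ) : Units.map (substA N).toMonoidHom q₂ = q₁ := by
  ext1
  show substA N (C (T 1)) = _
  rw [substA, eval₂_C]
  rfl

/-- After multiplication by a power of `A`, the element is a polynomial in `A` over the domain
`ℤ[T;T⁻¹]` with the infinitely many distinct roots `q ^ (N + 1)`. -/
lemma eq_zero_of_substA {P : Laurent₂} (h : ∀ N, 1 ≤ N → substA N P = 0) : P = 0 := by
  obtain ⟨n, f, hf⟩ := exists_T_pow P
  have hf0 : f = 0 := by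
    refine Polynomial.eq_zero_of_infinite_isRoot f (Set.infinite_of_injective_forall_mem
      (f := fun N : ℕ => (T ((N : ℤ) + 1) : ℤ[T;T⁻¹])) ?_ fun N => ?_)
    · intro a b hab
      have := congrArg (fun p : ℤ[T;T⁻¹] => p.coeff ((a : ℤ) + 1)) hab
      simp only [T_apply, if_true] at this
      split_ifs at this with h
      · omega
      · exact absurd this one_ne_zero
    · have h1 := congrArg (substA (N + 1)) hf
      rw [map_mul, h _ (by omega), zero_mul, substA, eval₂_toLaurent] at h1
      have e : ((q₁ ^ (N + 1) : (ℤ[T;T⁻¹])ˣ) : ℤ[T;T⁻¹]) = T ((N : ℤ) + 1) := by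
        rw [Units.val_pow_eq_pow_val, show (q₁ : ℤ[T;T⁻¹]) = T 1 from rfl, T_pow]
        simp
      rw [e] at h1
      exact h1
  rw [hf0, map_zero] at hf
  exact ((isUnit_T n).mul_left_eq_zero.1 hf.symm)

lemma bracket_q₁_pow_ne_zero {N : ℕ} (hN : 1 ≤ N) : bracket (q₁ ^ N) ≠ 0 := by
  have e : bracket (q₁ ^ N) = (T N - T (-N) : ℤ[T;T⁻¹]) := by
    rw [bracket, ← inv_pow, Units.val_pow_eq_pow_val, Units.val_pow_eq_pow_val,
      show (q₁ : ℤ[T;T⁻¹]) = T 1 from rfl,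
      show ((q₁⁻¹ : (ℤ[T;T⁻¹])ˣ) : ℤ[T;T⁻¹]) = T (-1) from rfl, T_pow, T_pow]
    simp
  rw [e]
  intro h
  have := congrArg (fun p : ℤ[T;T⁻¹] => p.coeff (N : ℤ)) (sub_eq_zero.1 h)
  simp only [T_apply, if_true] at this
  rw [if_neg (by omega)] at this
  exact one_ne_zero this

lemma bracket_q₁_ne_zero : bracket q₁ ≠ 0 := by
  simpa using bracket_q₁_pow_ne_zero (N := 1) le_rfl

lemma bracket_q₂_ne_zero : bracket q₂ ≠ 0 := by
  intro h
  have := congrArg (substA 1) h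
  rw [map_bracket, map_substA_q₂, map_zero] at this
  exact bracket_q₁_ne_zero this

lemma bracket_A₂_ne_zero : bracket A₂ ≠ 0 := by
  intro h
  have := congrArg (substA 1) h
  rw [map_bracket, map_substA_A₂, map_zero] at this
  exact bracket_q₁_pow_ne_zero le_rfl this

lemma bracket_mul_bracket₂_ne_zero : bracket A₂ ^ 2 - bracket q₂ ^ 2 ≠ 0 := by
  intro h
  -- At `A = q ^ 2` the product `{Aq}{A/q}` becomes `{q^3}{q}`. The value `A = q` would not do,
  -- since `{A/q}` vanishes there.
  have := congrArg (substA 2) h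
  rw [map_sub, map_pow, map_pow, map_bracket, map_bracket, map_substA_A₂, map_substA_q₂, map_zero,
    ← bracket_mul_bracket, ← pow_succ, pow_two, mul_div_cancel_right] at this
  exact mul_ne_zero (bracket_q₁_pow_ne_zero (by norm_num)) bracket_q₁_ne_zero this

lemma bracket_q_eq : bracket q = algebraMap Laurent₂ 𝕂 (bracket q₂) := (map_bracket _ _).symm

lemma bracket_A_eq : bracket A = algebraMap Laurent₂ 𝕂 (bracket A₂) := (map_bracket _ _).symm

lemma algebraMap_injective : Function.Injective (algebraMap Laurent₂ 𝕂) :=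
  IsFractionRing.injective Laurent₂ 𝕂

lemma bracket_q_ne_zero : bracket q ≠ 0 := by
  rw [bracket_q_eq]
  exact (map_ne_zero_iff _ algebraMap_injective).2 bracket_q₂_ne_zero

lemma bracket_A_ne_zero : bracket A ≠ 0 := by
  rw [bracket_A_eq]
  exact (map_ne_zero_iff _ algebraMap_injective).2 bracket_A₂_ne_zero

lemma dim_mul : dim * bracket q = bracket A := div_mul_cancel₀ _ bracket_q_ne_zero

lemma dim_ne_zero : dim ≠ 0 := div_ne_zero bracket_A_ne_zero bracket_q_ne_zero

lemma bracket_mul_bracket_eq : bracket (A * q) * bracket (A / q) =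
    algebraMap Laurent₂ 𝕂 (bracket A₂ ^ 2 - bracket q₂ ^ 2) := by
  rw [bracket_mul_bracket, bracket_q_eq, bracket_A_eq, map_sub, map_pow, map_pow]

/-! ### The HOMFLY polynomial -/

lemma Word.IsHomfly.unique {w : Word} {H H' : 𝕂} (h : w.IsHomfly H) (h' : w.IsHomfly H') :
    H = H' := by
  obtain ⟨m, P, hP, hN⟩ := h
  obtain ⟨m', P', hP', hN'⟩ := h'
  -- The two representations may have different denominators, so the numerators are compared after
  -- cross-multiplication.
  have h0 : bracket q₂ ^ m' * P - bracket q₂ ^ m * P' = 0 := by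
    refine eq_zero_of_substA fun N h1 => ?_
    simp only [map_sub, map_mul, map_pow, map_bracket, map_substA_q₂, hN N h1, hN' N h1]
    ring
  have h1 := congrArg (algebraMap Laurent₂ 𝕂) h0
  simp only [map_sub, map_mul, map_pow, hP, hP', ← bracket_q_eq, map_zero] at h1
  have hne : bracket q ^ (m + m') ≠ 0 := pow_ne_zero _ bracket_q_ne_zero
  refine mul_left_cancel₀ hne ?_
  linear_combination h1

/-- Both `dim * {q} = {A}` and `[N] {q} = {q^N}` have the shape required by
`BWord.planarSum_cleared`; the same cleared formula therefore serves in `𝕂` and after each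
substitution. -/
lemma BWord.isHomfly {B : BWord} (hB : B.link.IsLinkDiagram) :
    B.link.IsHomfly (B.framing A * B.planarSum dim (phi A q) (phiBar A q)) := by
  -- Any common upper bound for the cycle counts would do; their sum is one.
  set m := (B.resolutions.map fun ρ => ρ.cycles.components).sum with hm
  have hle : ∀ ρ ∈ B.resolutions, ρ.cycles.components ≤ m := fun ρ hρ =>
    List.single_le_sum (fun _ _ => Nat.zero_le _) _ (List.mem_map_of_mem hρ)
  refine ⟨m, B.framing A₂ * (B.resolutions.map fun ρ =>
      bracket A₂ ^ ρ.cycles.components * bracket q₂ ^ (m - ρ.cycles.components) *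
        phi A₂ q₂ ^ ρ.b * phiBar A₂ q₂ ^ ρ.c).sum, ?_, fun N _ => ?_⟩
  · rw [mul_left_comm, BWord.planarSum_cleared B dim _ _ _ _ dim_mul hle]
    simp only [map_mul, map_framing, map_list_sum, List.map_map, Function.comp_def, map_pow,
      map_bracket, map_phi, map_phiBar]
    rfl
  · rw [BWord.slN_link hB, mul_left_comm,
      BWord.planarSum_cleared B _ _ _ _ _ (quantumDim_mul N) hle]
    simp only [map_mul, map_framing, map_list_sum, List.map_map, Function.comp_def, map_pow,
      map_bracket, map_phi, map_phiBar, map_substA_A₂, map_substA_q₂]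

/-! ### The differential expansion for knots -/

/-- The planar sum of a knot divided by `D`. -/
def BWord.reducedSum (B : BWord) : Laurent₂ :=
  B.framing A₂ * (B.resolutions.map fun ρ =>
    bracket A₂ ^ (ρ.cycles.components - 1) * bracket q₂ ^ (ρ.b + ρ.c + 1 - ρ.cycles.components) *
      (A₂ : Laurent₂) ^ ρ.b * (-((A₂⁻¹ : Laurent₂ˣ) : Laurent₂)) ^ ρ.c).sum

/-- The two inequalities contained here make the truncated subtractions in `BWord.reducedSum`
genuine, and the parity makes its exponent of `{q}` even. The parity follows by comparing rotation
numbers with the all-unhooked resolution, which has one cycle. -/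
lemma BWord.components_resolution {B : BWord} (hB : B.link.IsLinkDiagram)
    (hK : B.link.components = 1) {ρ : Resolution} (hρ : ρ ∈ B.resolutions) :
    1 ≤ ρ.cycles.components ∧ ∃ j, ρ.b + ρ.c + 1 = ρ.cycles.components + 2 * j := by
  have hv : (⟨[], 0, 0⟩ : Trace).Valid := by simp [Trace.Valid]
  have hne : B ≠ [] := by
    rintro rfl
    exact absurd hK (by decide)
  have heval := fun {ρ} (hρ : ρ ∈ B.resolutions) =>
    Word.planar_eval (BWord.resolutions_planar hρ) (BWord.resolutions_run hB hρ)
  obtain ⟨-, h1, h2⟩ := heval hρ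
  obtain ⟨ρ₀, hρ₀, hb, hc, e⟩ := BWord.exists_resolution_count_eq hv rfl hB
  obtain ⟨-, h3, -⟩ := heval hρ₀
  have h4 := BWord.rot_resolution hρ
  have h5 := BWord.rot_resolution hρ₀
  have h6 := BWord.count_resolution_le hv rfl hB hρ
  rw [← Word.components_eq, ← Word.components_eq] at e h6
  refine ⟨h2 (BWord.resolutions_ne_nil hB hne hρ),
    (ρ.b + ρ.c + 1 - ρ.cycles.components) / 2, ?_⟩
  omega

lemma BWord.planarSum_eq_dim_mul {B : BWord} (hB : B.link.IsLinkDiagram)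
    (hK : B.link.components = 1) :
    B.framing A * B.planarSum dim (phi A q) (phiBar A q) =
      dim * algebraMap Laurent₂ 𝕂 B.reducedSum := by
  rw [BWord.reducedSum, map_mul, map_framing, mul_left_comm, map_list_sum, List.map_map,
    BWord.planarSum, ← List.sum_map_mul_left (f := _ ∘ _)]
  refine congrArg (B.framing A * List.sum ·) (List.map_congr_left fun ρ hρ => ?_)
  obtain ⟨h1, j, hj⟩ := BWord.components_resolution hB hK hρ
  obtain ⟨a, ha⟩ := Nat.exists_eq_add_of_le h1
  rw [Function.comp_apply, ha]
  rw [ha] at hj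
  have hbc : ρ.b + ρ.c = a + 2 * j := by omega
  simp only [map_mul, map_pow, map_neg, ← bracket_q_eq, ← bracket_A_eq]
  rw [show ρ.b + ρ.c + 1 - (1 + a) = 2 * j by omega, Nat.add_sub_cancel_left, ← dim_mul]
  -- Of the `b + c = a + 2j` factors `{q}` in `φ^b φ̄^c`, `a` turn the surplus powers of `D` into
  -- powers of `{A}`. Here `a` is the cycle count minus one.
  have e : bracket q ^ ρ.b * bracket q ^ ρ.c = bracket q ^ a * bracket q ^ (2 * j) := by
    rw [← pow_add, ← pow_add, hbc]
  have eA : algebraMap Laurent₂ 𝕂 A₂ = (A : 𝕂) := rfl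
  have eA' : algebraMap Laurent₂ 𝕂 ((A₂⁻¹ : Laurent₂ˣ) : Laurent₂) = ((A⁻¹ : 𝕂ˣ) : 𝕂) := rfl
  simp only [phi, phiBar, mul_pow, eA, eA', pow_add, pow_one]
  linear_combination dim * dim ^ a * (A : 𝕂) ^ ρ.b * (-((A⁻¹ : 𝕂ˣ) : 𝕂)) ^ ρ.c * e

/-- The number 1 is itself rewritten as a planar sum, with `D = 1` and `q` replaced by `A`. The two
sums then agree term by term except that `{q}^(2j)` stands in place of `{A}^(2j)`, and the
difference of these is divisible by `{A}^2 - {q}^2`. -/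
lemma BWord.dvd_reducedSum_sub_one {B : BWord} (hB : B.link.IsLinkDiagram)
    (hK : B.link.components = 1) : bracket A₂ ^ 2 - bracket q₂ ^ 2 ∣ B.reducedSum - 1 := by
  have h1 := BWord.framing_mul B A₂
  rw [← BWord.planarSum_one, BWord.planarSum] at h1
  rw [← h1, BWord.reducedSum, ← mul_sub]
  refine dvd_mul_of_dvd_right (dvd_list_sum_sub fun ρ hρ => ?_) _
  obtain ⟨h1, j, hj⟩ := BWord.components_resolution hB hK hρ
  obtain ⟨a, ha⟩ := Nat.exists_eq_add_of_le h1
  rw [ha] at hj ⊢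
  have hbc : ρ.b + ρ.c = a + 2 * j := by omega
  rw [show ρ.b + ρ.c + 1 - (1 + a) = 2 * j by omega, Nat.add_sub_cancel_left]
  have e : bracket A₂ ^ ρ.b * bracket A₂ ^ ρ.c = bracket A₂ ^ a * bracket A₂ ^ (2 * j) := by
    rw [← pow_add, ← pow_add, hbc]
  have hd := sub_dvd_pow_sub_pow (bracket A₂ ^ 2) (bracket q₂ ^ 2) j
  rw [← pow_mul, ← pow_mul] at hd
  obtain ⟨z, hz⟩ := hd
  refine ⟨-(bracket A₂ ^ a * (A₂ : Laurent₂) ^ ρ.b *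
    (-((A₂⁻¹ : Laurent₂ˣ) : Laurent₂)) ^ ρ.c * z), ?_⟩
  simp only [phi, phiBar, mul_pow, one_pow, one_mul]
  linear_combination -bracket A₂ ^ a * (A₂ : Laurent₂) ^ ρ.b *
    (-((A₂⁻¹ : Laurent₂ˣ) : Laurent₂)) ^ ρ.c * hz -
    (A₂ : Laurent₂) ^ ρ.b * (-((A₂⁻¹ : Laurent₂ˣ) : Laurent₂)) ^ ρ.c * e

end BipartiteHomfly
end

open BipartiteHomfly
theorem mainTheorem12 (B : BWord) (hB : B.link.IsLinkDiagram) :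
    -- the HOMFLY polynomial is well defined and is given by the planar sum
    (∃! H : 𝕂, B.link.IsHomfly H) ∧
    (∀ H : 𝕂, B.link.IsHomfly H →
      H = B.framing A * B.planarSum dim (phi A q) (phiBar A q)) ∧
    -- its value at `A = q`, where `D = 1`
    (B.link.slN 1 = B.framing q₁ * B.planarSum 1 (phi q₁ q₁) (phiBar q₁ q₁) ∧
      B.framing q₁ * B.planarSum 1 (phi q₁ q₁) (phiBar q₁ q₁) =
        B.framing q₁ *
          ((1 + phi q₁ q₁) ^ B.count .black * (1 + phiBar q₁ q₁) ^ B.count .white) ∧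
      B.framing q₁ *
          ((1 + phi q₁ q₁) ^ B.count .black * (1 + phiBar q₁ q₁) ^ B.count .white) = 1) ∧
    -- the differential expansion for knots
    (B.link.components = 1 → ∀ H : 𝕂, B.link.IsHomfly H →
      ∃! F : Laurent₂,
        H = dim * (1 + algebraMap Laurent₂ 𝕂 F * bracket (A * q) * bracket (A / q))) := by
  have hH := BWord.isHomfly hB
  refine ⟨⟨_, hH, fun H h => h.unique hH⟩, fun H h => h.unique hH, ⟨?_, ?_, ?_⟩,
    fun hK H h => ?_⟩
  · have := BWord.slN_link hB 1
    rwa [pow_one, quantumDim_one] at this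
  · rw [BWord.planarSum_one]
  · exact BWord.framing_mul B q₁
  · obtain ⟨F, hF⟩ := BWord.dvd_reducedSum_sub_one hB hK
    have e : H = dim * (1 + algebraMap Laurent₂ 𝕂 F * bracket (A * q) * bracket (A / q)) := by
      rw [h.unique hH, BWord.planarSum_eq_dim_mul hB hK, mul_assoc, bracket_mul_bracket_eq,
        ← map_mul, mul_comm F, ← hF, map_sub, map_one, add_sub_cancel]
    refine ⟨F, e, fun F' hF' => ?_⟩
    dsimp only at hF'
    -- Uniqueness: the nonzero factors `dim` and `{Aq}{A/q}` are cancelled in turn.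
    rw [e] at hF'
    have h1 := mul_left_cancel₀ dim_ne_zero hF'
    rw [mul_assoc, mul_assoc, bracket_mul_bracket_eq, ← map_mul, ← map_mul] at h1
    exact (mul_right_cancel₀ bracket_mul_bracket₂_ne_zero
      (algebraMap_injective (add_left_cancel h1))).symm
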